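/- Graphs are simple and undirected, possibly empty and possibly infinite, and sets of graphs are understood up to isomorphism. For a set $\Sigma$ of unary relation symbols, a *$\Sigma$-expanded graph* (or *$\Sigma$-expansion* of $G$) is a graph $G$ together with a subset of $V(G)$ for each symbol of $\Sigma$; formulas are first-order formulas (with equality) in the adjacency relation $E$ and the symbols of $\Sigma$. *Transductions.* A *simple interpretation* $\mathsf I=(\nu(x),\eta(x,y))$ of graphs in $\Sigma$-expanded graphs is a pair of formulas such that $\eta(x,y)\leftrightarrow\eta(y,x)$ and $\eta(x,y)\rightarrow x\neq y$ hold in all $\Sigma$-expanded graphs; $\mathsf I(G^+)$ is the graph with vertex set $\nu(G^+)$ in which $u,v$ are adjacent if and only if $G^+\models\eta(u,v)$. A *non-copying transduction* $\mathsf T$ is a pair $(\Sigma,\mathsf I)$ of a finite set $\Sigma$ of unary relation symbols and a simple interpretation $\mathsf I$ of graphs in $\Sigma$-expanded graphs; it maps a graph $G$ to the set $\mathsf T(\{G\})$ of all graphs $\mathsf I(G^+)$, where $G^+$ ranges over the $\Sigma$-expansions of $G$. For a positive integer $k$, the *copy operation* $\mathsf C_k$ maps $G$ to the graph obtained from $k$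 disjoint copies of $G$ by making the copies of each vertex pairwise adjacent. A *transduction* is a finite composition of copy operations and non-copying transductions. A transduction $\mathsf T'$ *subsumes* $\mathsf T$ if $\mathsf T'(\{G\})\supseteq\mathsf T(\{G\})$ for every graph $G$. *Immersive transductions.* For a tuple $\bar v$ of vertices of a $\Sigma$-expanded graph $G$, let $B_r^G(\bar v)$ be the expanded subgraph of $G$ induced by the vertices at distance at most $r$ from some entry of $\bar v$. A formula $\varphi(x_1,\dots,x_k)$ is *$r$-local* if $G\models\varphi(\bar v)\iff B_r^G(\bar v)\models\varphi(\bar v)$ for every $\Sigma$-expanded graph $G$ and all $\bar v\in V(G)^k$; it is *strongly $r$-local* if moreover $G\models\varphi(\bar v)$ implies $\mathrm{dist}_G(v_i,v_j)\le r$ for all $i<j$. A non-copying transduction is *immersive* if, for some $r$, both formulas $\nu,\eta$ of its interpretation are strongly $r$-local. *Perturbations.* The *subset complementation* is the non-copying transduction with a single unary symbol $M$, with $\nu$ always true and with $$\eta(x,y):=\; x\neq y\;\wedge\;\neg\bigl(E(x,y)\leftrightarrow (M(x)\wedge M(y))\bigr),$$ that is, it complements the adjacency inside the subset defined by $M$.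 A *perturbation* is a composition of a fixed finite number of subset complementations. **Theorem (Transduction normal form).** For every transduction $\mathsf T$ there are a positive integer $k$, an immersive transduction $\mathsf T_{\rm imm}$ and a perturbation $\mathsf P$ such that $\mathsf P\circ\mathsf T_{\rm imm}\circ\mathsf C_k$ subsumes $\mathsf T$. If $\mathsf T$ is a non-copying transduction, then there are an immersive transduction $\mathsf T_{\rm imm}$ and a perturbation $\mathsf P$ such that $\mathsf P\circ\mathsf T_{\rm imm}$ subsumes $\mathsf T$. -/

import Mathlib

universe u

namespace FOTransductions

open scoped FirstOrder

/-! ### First-order logic over graphs expanded by unary relations -/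

/-- Relation symbols for graphs expanded by unary relations named by `S`: one binary adjacency
symbol `E` and a unary symbol for each `s : S`. -/
inductive ExpRel (S : Type) : ℕ → Type
  | adj : ExpRel S 2
  | unary (s : S) : ExpRel S 1

/-- The (relational) first-order language of `S`-expanded graphs. -/
def expLang (S : Type) : FirstOrder.Language.{0, 0} := ⟨fun _ => Empty, ExpRel S⟩

/-- The adjacency symbol `E`. -/
def symE (S : Type) : (expLang S).Relations 2 := ExpRel.adj

/-- The unary symbol named `s`. -/
def symU {S : Type} (s : S) : (expLang S).Relations 1 := ExpRel.unary s

/-- An `S`-expanded graph: a graph `G` on `V` together with a subset `P s` of `V` for each `s : S`,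
viewed as a first-order structure. -/
@[reducible] def expStructure {S : Type} {V : Type u} (G : SimpleGraph V) (P : S → Set V) :
    (expLang S).Structure V where
  funMap f _ := Empty.elim f
  RelMap r x :=
    match r, x with
    | ExpRel.adj, x => G.Adj (x 0) (x 1)
    | ExpRel.unary s, x => x 0 ∈ P s

/-- `(G, P) ⊨ φ(v)`. -/
def Sat {S : Type} {V : Type u} (G : SimpleGraph V) (P : S → Set V) {k : ℕ}
    (φ : (expLang S).Formula (Fin k)) (v : Fin k → V) : Prop :=
  letI := expStructure G P
  φ.Realize v

/-! ### Locality -/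

/-- The union of the closed balls of radius `r` around the entries of `v`. -/
def ball {V : Type u} (G : SimpleGraph V) (r : ℕ) {k : ℕ} (v : Fin k → V) : Set V :=
  {w | ∃ i, G.edist (v i) w ≤ (r : ℕ∞)}

theorem mem_ball {V : Type u} (G : SimpleGraph V) (r : ℕ) {k : ℕ} (v : Fin k → V) (i : Fin k) :
    v i ∈ ball G r v :=
  ⟨i, by simp⟩

/-- `φ` is `r`-local: in every expanded graph, the truth of `φ(v)` coincides with its truth in the
expanded subgraph induced by the ball of radius `r` around the tuple `v`. -/
def IsLocal {S : Type} (r : ℕ) {k : ℕ} (φ : (expLang S).Formula (Fin k)) : Prop :=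
  ∀ (V : Type u) (G : SimpleGraph V) (P : S → Set V) (v : Fin k → V),
    Sat G P φ v ↔
      Sat (G.induce (ball G r v)) (fun s => {w : ball G r v | (w : V) ∈ P s}) φ
        (fun i => ⟨v i, mem_ball G r v i⟩)

/-- `φ` is strongly `r`-local: it is `r`-local and `φ(v)` implies that the entries of `v` are
pairwise at distance at most `r`. -/
def IsStronglyLocal {S : Type} (r : ℕ) {k : ℕ} (φ : (expLang S).Formula (Fin k)) : Prop :=
  IsLocal.{u} r φ ∧
    ∀ (V : Type u) (G : SimpleGraph V) (P : S → Set V) (v : Fin k → V),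
      Sat G P φ v → ∀ i j : Fin k, i < j → G.edist (v i) (v j) ≤ (r : ℕ∞)

/-! ### Interpretations and transductions -/

/-- A simple interpretation of graphs in `S`-expanded graphs: a pair `(ν(x), η(x, y))` of formulas,
where `η` is symmetric and anti-reflexive in all `S`-expanded graphs. -/
structure SimpleInterpretation (S : Type) where
  ν : (expLang S).Formula (Fin 1)
  η : (expLang S).Formula (Fin 2)
  symm : ∀ (V : Type u) (G : SimpleGraph V) (P : S → Set V) (x y : V),
    Sat G P η ![x, y] ↔ Sat G P η ![y, x]
  irrefl : ∀ (V : Type u) (G : SimpleGraph V) (P : S → Set V) (x y : V),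
    Sat G P η ![x, y] → x ≠ y

/-- The graph `I(G, P)`, with vertex set `ν(G, P)` and adjacency `η`. -/
def SimpleInterpretation.interp {S : Type} (I : SimpleInterpretation.{u} S) {V : Type u}
    (G : SimpleGraph V) (P : S → Set V) : SimpleGraph {x : V // Sat G P I.ν ![x]} where
  Adj a b := Sat G P I.η ![a.1, b.1]
  symm := ⟨fun a b h => (I.symm V G P a.1 b.1).1 h⟩
  loopless := ⟨fun a h => I.irrefl V G P a.1 a.1 h rfl⟩

/-- The interpretation is strongly local: for some `r`, both of its formulas are strongly
`r`-local. -/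
def SimpleInterpretation.IsStronglyLocal {S : Type} (I : SimpleInterpretation.{u} S) : Prop :=
  ∃ r : ℕ, FOTransductions.IsStronglyLocal.{u} r I.ν ∧ FOTransductions.IsStronglyLocal.{u} r I.η

/-- A non-copying transduction: a finite set of unary relation symbols and a simple interpretation
of graphs in graphs expanded by these. -/
structure NonCopyingTransduction where
  symbols : Type
  finite_symbols : Finite symbols
  interpretation : SimpleInterpretation.{u} symbols

/-- `H` is (up to isomorphism) a `T`-transduction of `G`. -/
def NonCopyingTransduction.Produces (T : NonCopyingTransduction.{u}) {V W : Type u}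
    (G : SimpleGraph V) (H : SimpleGraph W) : Prop :=
  ∃ P : T.symbols → Set V, Nonempty (H ≃g T.interpretation.interp G P)

/-- A non-copying transduction is immersive if its interpretation is strongly local. -/
def NonCopyingTransduction.IsImmersive (T : NonCopyingTransduction.{u}) : Prop :=
  T.interpretation.IsStronglyLocal

/-- The `k`-copy operation: `k` disjoint copies of `G`, where the copies of each vertex of `G` are
made pairwise adjacent. -/
def copyGraph (k : ℕ) {V : Type u} (G : SimpleGraph V) : SimpleGraph (V × Fin k) where
  Adj a b := (G.Adj a.1 b.1 ∧ a.2 = b.2) ∨ (a.1 = b.1 ∧ a.2 ≠ b.2)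
  symm := ⟨fun _ _ h => h.imp (fun h => ⟨h.1.symm, h.2.symm⟩) (fun h => ⟨h.1.symm, h.2.symm⟩)⟩
  loopless := ⟨fun _ h => h.elim (fun h => h.1.ne rfl) (fun h => h.2 rfl)⟩

/-- The elementary transductions: copy operations and non-copying transductions. -/
inductive Step : Type 1
  | copy (k : ℕ) (hk : 0 < k) : Step
  | nonCopying (T : NonCopyingTransduction.{u}) : Step

/-- `H` is, up to isomorphism, an output of the elementary transduction on input `G`. -/
def Step.Produces (s : Step.{u}) {V W : Type u} (G : SimpleGraph V) (H : SimpleGraph W) : Prop :=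
  match s with
  | .copy k _ => Nonempty (H ≃g copyGraph k G)
  | .nonCopying T => T.Produces G H

/-- A transduction: a finite composition of copy operations and non-copying transductions, listed
in the order in which they are applied. -/
structure Transduction where
  steps : List Step.{u}

/-- `H` is, up to isomorphism, obtained from `G` by performing the listed steps one after the
other. -/
def StepsProduce : List Step.{u} → ∀ {V W : Type u}, SimpleGraph V → SimpleGraph W → Prop
  | [], _, _, G, H => Nonempty (H ≃g G)
  | s :: l, _, _, G, H => ∃ (U : Type u) (K : SimpleGraph U), s.Produces G K ∧ StepsProduce l K H

/-- `H` belongs to `T({G})`. -/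
def Transduction.Produces (T : Transduction.{u}) {V W : Type u}
    (G : SimpleGraph V) (H : SimpleGraph W) : Prop :=
  StepsProduce T.steps G H

/-- The composition `T' ∘ T`: first `T`, then `T'`. -/
def Transduction.comp (T' T : Transduction.{u}) : Transduction.{u} := ⟨T.steps ++ T'.steps⟩

/-- A non-copying transduction as a transduction. -/
def NonCopyingTransduction.toTransduction (T : NonCopyingTransduction.{u}) : Transduction.{u} :=
  ⟨[.nonCopying T]⟩

/-- The `k`-copy operation as a transduction. -/
def copyOperation (k : ℕ) (hk : 0 < k) : Transduction.{u} := ⟨[.copy k hk]⟩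

/-- `T'` subsumes `T`: for every graph `G`, `T'({G}) ⊇ T({G})`. -/
def Transduction.Subsumes (T' T : Transduction.{u}) : Prop :=
  ∀ (V : Type u) (G : SimpleGraph V) (W : Type u) (H : SimpleGraph W),
    T.Produces G H → T'.Produces G H

/-! ### Subset complementations and perturbations -/

/-- The formula `x ≠ y ∧ ¬ (E(x, y) ↔ (M(x) ∧ M(y)))`, where `M` is the only unary symbol. -/
def complFormula : (expLang Unit).Formula (Fin 2) :=
  let x : (expLang Unit).Term (Fin 2) := FirstOrder.Language.Term.var 0
  let y : (expLang Unit).Term (Fin 2) := FirstOrder.Language.Term.var 1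
  let E := symE Unit
  let M := symU ()
  ∼(x.equal y) ⊓ ∼((E.formula₂ x y).iff (M.formula₁ x ⊓ M.formula₁ y))

theorem sat_complFormula {V : Type u} (G : SimpleGraph V) (P : Unit → Set V) (x y : V) :
    Sat G P complFormula ![x, y] ↔ x ≠ y ∧ ¬(G.Adj x y ↔ (x ∈ P () ∧ y ∈ P ())) := by
  let _ := expStructure G P
  have hE : ∀ z : Fin 2 → V,
      FirstOrder.Language.Structure.RelMap (symE Unit) z ↔ G.Adj (z 0) (z 1) := fun _ => Iff.rfl
  have hM : ∀ z : Fin 1 → V,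
      FirstOrder.Language.Structure.RelMap (symU ()) z ↔ z 0 ∈ P () := fun _ => Iff.rfl
  simp [Sat, complFormula, FirstOrder.Language.Formula.realize_rel₁,
    FirstOrder.Language.Formula.realize_rel₂, hE, hM]

/-- The subset complementation transduction: it keeps all vertices and complements the adjacency
inside the subset defined by its single unary symbol. -/
def subsetComplementation : NonCopyingTransduction.{u} where
  symbols := Unit
  finite_symbols := inferInstance
  interpretation :=
    { ν := ⊤
      η := complFormula
      symm := fun V G P x y => by
        rw [sat_complFormula, sat_complFormula, G.adj_comm, ne_comm, and_comm (a := x ∈ P ())]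
      irrefl := fun V G P x y h => ((sat_complFormula G P x y).1 h).1 }

/-- A perturbation: the composition of a fixed number of subset complementations. -/
def Transduction.IsPerturbation (T : Transduction.{u}) : Prop :=
  ∃ m : ℕ, T.steps = List.replicate m (Step.nonCopying subsetComplementation)

end FOTransductions

/-!
The proof has two parts.

*Copying.* In a list of elementary transductions all copy operations can be moved to the front and
merged (`exists_nonCopyingTransduction_copyGraph`): a copy operation after a non-copying
transduction is replaced by one before it, with the transduction simulated in one of the copies
(`NonCopyingTransduction.exists_copyGraph`), copies of copies are interpreted in more copies
(`exists_nonCopyingTransduction_copyGraph_copyGraph`), and non-copying transductions compose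
(`NonCopyingTransduction.exists_comp`). The simulation and the composition rest on the
relativization of formulas to definable substructures, `Expressible.realize_restrict`. Formulas are never written down: a relation
on vertices is `Expressible` if some formula defines it, and this notion has the expected closure
properties.

*Locality.* For a non-copying transduction, the expansion of the input graph may be chosen depending
on the graph. So it suffices to have a version of Gaifman's theorem inside a fixed structure, where
sentences play no role. For a fixed formula there are `N` and `L` such that its truth at a tuple is
determined by the local type of the tuple, which records the behaviour of `L` successive choices of
vertices within distance `N` (`exists_realize_iff_of_localEquiv`). The induction step is
`LocalEquiv.exists_insert`: a vertex far from a tuple is matched through a comparison of the sizes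
of scattered sets of vertices of its local type.

There are finitely many local types, they are definable, and they only depend on a ball around the
tuple. For far apart vertices `x` and `y`, the adjacency in the interpreted graph is a symmetric
relation `R` between the local types of `x` and of `y`. Such a relation is a sum modulo 2 of
complete graphs on unions of types, that is, a perturbation (`exists_oddlyTogether_iff`). The modulo-2
difference of the interpreted adjacency and `R` vanishes at large distance, and at small distance it
depends on the local type of `(x, y)` only. Marking the local types for which it holds defines an
immersive transduction (`NonCopyingTransduction.exists_isImmersive`).
-/

namespace FOTransductions

open scoped FirstOrder

/-! ### Distances -/

theorem edist_le_zero_iff {V : Type u} (G : SimpleGraph V) (x y : V) :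
    G.edist x y ≤ ((0 : ℕ) : ℕ∞) ↔ x = y := by
  simp

theorem edist_le_succ_iff {V : Type u} (G : SimpleGraph V) (x y : V) (d : ℕ) :
    G.edist x y ≤ ((d + 1 : ℕ) : ℕ∞) ↔
      ∃ z, G.edist x z ≤ (d : ℕ∞) ∧ (z = y ∨ G.Adj z y) := by
  constructor
  · intro h
    obtain ⟨p, hp⟩ := SimpleGraph.exists_walk_of_edist_ne_top
      (ne_top_of_le_ne_top (ENat.natCast_ne_top _) h)
    rw [← hp] at h
    have hl : p.length ≤ d + 1 := by exact_mod_cast h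
    by_cases hn : p.Nil
    · exact ⟨y, by rw [hn.eq]; simp, Or.inl rfl⟩
    · refine ⟨p.penultimate, ?_, Or.inr (p.adj_penultimate hn)⟩
      refine (SimpleGraph.edist_le p.dropLast).trans ?_
      have : p.dropLast.length ≤ d := by
        simp only [SimpleGraph.Walk.length_dropLast]; omega
      exact_mod_cast this
  · rintro ⟨z, hz, h⟩
    have h1 : G.edist z y ≤ 1 := by
      rw [SimpleGraph.edist_le_one_iff_adj_or_eq]; exact h.symm
    calc G.edist x y ≤ G.edist x z + G.edist z y := SimpleGraph.edist_triangle
      _ ≤ (d : ℕ∞) + 1 := add_le_add hz h1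
      _ = _ := by push_cast; rfl

theorem edist_le_add {V : Type u} (G : SimpleGraph V) {x y z : V} {d e : ℕ}
    (h : G.edist x y ≤ (d : ℕ∞)) (h' : G.edist y z ≤ (e : ℕ∞)) :
    G.edist x z ≤ ((d + e : ℕ) : ℕ∞) := by
  push_cast
  exact SimpleGraph.edist_triangle.trans (add_le_add h h')

theorem edist_le_mono {V : Type u} (G : SimpleGraph V) {x y : V} {d e : ℕ}
    (h : G.edist x y ≤ (d : ℕ∞)) (hde : d ≤ e) : G.edist x y ≤ (e : ℕ∞) :=
  h.trans (by exact_mod_cast hde)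

theorem edist_le_of_edist_induce_le {V : Type u} (G : SimpleGraph V) (A : Set V) (x y : A)
    (d : ℕ) (h : (G.induce A).edist x y ≤ (d : ℕ∞)) : G.edist (x : V) y ≤ (d : ℕ∞) := by
  induction d generalizing y with
  | zero => rw [edist_le_zero_iff] at h ⊢; rw [h]
  | succ d ih =>
    rw [edist_le_succ_iff] at h ⊢
    obtain ⟨z, hz, h⟩ := h
    exact ⟨z, ih z hz, h.imp (fun h => congrArg _ h) (fun h => h)⟩

/-- Shortest paths starting at `x` stay in the ball around `x`, so induced subgraphs containing
the ball have the same small distances from `x`. -/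
theorem edist_induce_le_iff {V : Type u} (G : SimpleGraph V) (A : Set V) (x y : A)
    (d : ℕ) (hA : ∀ z, G.edist (x : V) z ≤ (d : ℕ∞) → z ∈ A) :
    (G.induce A).edist x y ≤ (d : ℕ∞) ↔ G.edist (x : V) y ≤ (d : ℕ∞) := by
  refine ⟨edist_le_of_edist_induce_le G A x y d, fun h => ?_⟩
  induction d generalizing y with
  | zero => rw [edist_le_zero_iff] at h ⊢; exact Subtype.ext h
  | succ d ih =>
    rw [edist_le_succ_iff] at h ⊢
    obtain ⟨z, hz, h⟩ := h
    refine ⟨⟨z, hA z (edist_le_mono G hz (Nat.le_succ d))⟩,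
      ih _ (fun w hw => hA w (edist_le_mono G hw (Nat.le_succ d))) hz,
      h.imp (fun h => Subtype.ext h) (fun h => h)⟩

/-! ### Local back-and-forth equivalence -/

section BackForth

variable {S : Type} {V W : Type u}

/-- The pairs in `R` match in colours and in all distances up to `N`. -/
def AtomEquiv (G : SimpleGraph V) (P : S → Set V) (H : SimpleGraph W) (Q : S → Set W) (N : ℕ)
    (R : Set (V × W)) : Prop :=
  (∀ p ∈ R, ∀ q ∈ R, ∀ d ≤ N, G.edist p.1 q.1 ≤ (d : ℕ∞) ↔ H.edist p.2 q.2 ≤ (d : ℕ∞)) ∧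
    ∀ p ∈ R, ∀ s, p.1 ∈ P s ↔ p.2 ∈ Q s

/-- The duplicator wins the `n`-round back-and-forth game from the position `R`, when in each round
the spoiler has to play within distance `N` of a vertex played before. A position is the set of
pairs of corresponding vertices, so that neither an order nor an indexing of them matters. -/
def LocalEquiv (G : SimpleGraph V) (P : S → Set V) (H : SimpleGraph W) (Q : S → Set W) (N : ℕ) :
    ℕ → Set (V × W) → Prop
  | 0, R => AtomEquiv G P H Q N R
  | n + 1, R => AtomEquiv G P H Q N R ∧
      (∀ a, (∃ p ∈ R, G.edist p.1 a ≤ (N : ℕ∞)) → ∃ b, LocalEquiv G P H Q N n (insert (a, b) R)) ∧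
      (∀ b, (∃ p ∈ R, H.edist p.2 b ≤ (N : ℕ∞)) → ∃ a, LocalEquiv G P H Q N n (insert (a, b) R))

variable {G : SimpleGraph V} {P : S → Set V} {H : SimpleGraph W} {Q : S → Set W} {N N' n n' : ℕ}
  {R R' : Set (V × W)}

theorem AtomEquiv.mono (h : AtomEquiv G P H Q N' R') (hN : N ≤ N') (hR : R ⊆ R') :
    AtomEquiv G P H Q N R :=
  ⟨fun p hp q hq d hd => h.1 p (hR hp) q (hR hq) d (hd.trans hN), fun p hp => h.2 p (hR hp)⟩

theorem LocalEquiv.atom (h : LocalEquiv G P H Q N n R) : AtomEquiv G P H Q N R := by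
  cases n with
  | zero => exact h
  | succ n => exact h.1

theorem LocalEquiv.mono_subset (h : LocalEquiv G P H Q N' n R') (hN : N ≤ N') (hR : R ⊆ R') :
    LocalEquiv G P H Q N n R := by
  induction n generalizing R R' with
  | zero => exact AtomEquiv.mono h hN hR
  | succ n ih =>
    obtain ⟨h0, h1, h2⟩ := h
    refine ⟨h0.mono hN hR, ?_, ?_⟩
    · rintro a ⟨p, hp, ha⟩
      obtain ⟨b, hb⟩ := h1 a ⟨p, hR hp, edist_le_mono _ ha hN⟩
      exact ⟨b, ih hb (Set.insert_subset_insert hR)⟩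
    · rintro b ⟨p, hp, hb⟩
      obtain ⟨a, ha⟩ := h2 b ⟨p, hR hp, edist_le_mono _ hb hN⟩
      exact ⟨a, ih ha (Set.insert_subset_insert hR)⟩

theorem LocalEquiv.pred (h : LocalEquiv G P H Q N (n + 1) R) : LocalEquiv G P H Q N n R := by
  induction n generalizing R with
  | zero => exact h.atom
  | succ n ih =>
    refine ⟨h.atom, fun a ha => ?_, fun b hb => ?_⟩
    · obtain ⟨b, hb⟩ := h.2.1 a ha
      exact ⟨b, ih hb⟩
    · obtain ⟨a, ha⟩ := h.2.2 b hb
      exact ⟨a, ih ha⟩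

theorem LocalEquiv.mono (h : LocalEquiv G P H Q N' n' R') (hN : N ≤ N') (hn : n ≤ n')
    (hR : R ⊆ R') : LocalEquiv G P H Q N n R := by
  replace h := h.mono_subset hN hR
  induction n', hn using Nat.le_induction with
  | base => exact h
  | succ m hm ih => exact ih h.pred

theorem LocalEquiv.edist_iff (h : LocalEquiv G P H Q N n R) {p q : V × W} (hp : p ∈ R) (hq : q ∈ R)
    {d : ℕ} (hd : d ≤ N) : G.edist p.1 q.1 ≤ (d : ℕ∞) ↔ H.edist p.2 q.2 ≤ (d : ℕ∞) :=
  h.atom.1 p hp q hq d hd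

theorem AtomEquiv.union (h : AtomEquiv G P H Q N R) (h' : AtomEquiv G P H Q N R')
    (hG : ∀ p ∈ R, ∀ q ∈ R', ¬ G.edist p.1 q.1 ≤ (N : ℕ∞))
    (hH : ∀ p ∈ R, ∀ q ∈ R', ¬ H.edist p.2 q.2 ≤ (N : ℕ∞)) :
    AtomEquiv G P H Q N (R ∪ R') := by
  refine ⟨?_, ?_⟩
  · rintro p (hp | hp) q (hq | hq) d hd
    · exact h.1 p hp q hq d hd
    · exact iff_of_false (fun h => hG p hp q hq (edist_le_mono _ h hd))
        (fun h => hH p hp q hq (edist_le_mono _ h hd))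
    · rw [SimpleGraph.edist_comm, SimpleGraph.edist_comm (G := H)]
      exact iff_of_false (fun h => hG q hq p hp (edist_le_mono _ h hd))
        (fun h => hH q hq p hp (edist_le_mono _ h hd))
    · exact h'.1 p hp q hq d hd
  · rintro p (hp | hp)
    · exact h.2 p hp
    · exact h'.2 p hp

/-- In `n` rounds, the moves on either part of the union of two positions far apart from each other
do not interfere with the other part. -/
theorem LocalEquiv.union (h : LocalEquiv G P H Q N n R) (h' : LocalEquiv G P H Q N n R')
    (hG : ∀ p ∈ R, ∀ q ∈ R', ¬ G.edist p.1 q.1 ≤ (((2 * n + 1) * N : ℕ) : ℕ∞))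
    (hH : ∀ p ∈ R, ∀ q ∈ R', ¬ H.edist p.2 q.2 ≤ (((2 * n + 1) * N : ℕ) : ℕ∞)) :
    LocalEquiv G P H Q N n (R ∪ R') := by
  induction n generalizing R R' with
  | zero =>
    have h0 : (2 * 0 + 1) * N = N := by ring
    rw [h0] at hG hH
    exact AtomEquiv.union h h' hG hH
  | succ n ih =>
    have hN : N ≤ (2 * (n + 1) + 1) * N := Nat.le_mul_of_pos_left _ (by omega)
    have hle : N + (2 * n + 1) * N ≤ (2 * (n + 1) + 1) * N := by nlinarith
    have hle' : (2 * n + 1) * N ≤ (2 * (n + 1) + 1) * N := by nlinarith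
    -- A vertex within distance `N` of one part is still far enough from the other part.
    have key : ∀ a b, (∃ p ∈ R, G.edist p.1 a ≤ (N : ℕ∞) ∧ H.edist p.2 b ≤ (N : ℕ∞)) →
        LocalEquiv G P H Q N n (insert (a, b) R) →
        LocalEquiv G P H Q N n (insert (a, b) (R ∪ R')) := by
      rintro a b ⟨p, hp, ha, hb⟩ hab
      rw [← Set.insert_union]
      refine ih hab h'.pred ?_ ?_
      · rintro r (rfl | hr) q hq hd
        · exact hG p hp q hq (edist_le_mono _ (edist_le_add _ ha hd) hle)
        · exact hG r hr q hq (edist_le_mono _ hd hle')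
      · rintro r (rfl | hr) q hq hd
        · exact hH p hp q hq (edist_le_mono _ (edist_le_add _ hb hd) hle)
        · exact hH r hr q hq (edist_le_mono _ hd hle')
    have key' : ∀ a b, (∃ p ∈ R', G.edist p.1 a ≤ (N : ℕ∞) ∧ H.edist p.2 b ≤ (N : ℕ∞)) →
        LocalEquiv G P H Q N n (insert (a, b) R') →
        LocalEquiv G P H Q N n (insert (a, b) (R ∪ R')) := by
      rintro a b ⟨p, hp, ha, hb⟩ hab
      rw [← Set.union_insert]
      refine ih h.pred hab ?_ ?_
      · rintro r hr q (rfl | hq) hd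
        · rw [SimpleGraph.edist_comm] at hd
          refine hG r hr p hp ?_
          rw [SimpleGraph.edist_comm]
          exact edist_le_mono _ (edist_le_add _ ha hd) hle
        · exact hG r hr q hq (edist_le_mono _ hd hle')
      · rintro r hr q (rfl | hq) hd
        · rw [SimpleGraph.edist_comm] at hd
          refine hH r hr p hp ?_
          rw [SimpleGraph.edist_comm]
          exact edist_le_mono _ (edist_le_add _ hb hd) hle
        · exact hH r hr q hq (edist_le_mono _ hd hle')
    have near : ∀ {T : Set (V × W)} {a b p}, p ∈ T → LocalEquiv G P H Q N n (insert (a, b) T) →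
        (G.edist p.1 a ≤ (N : ℕ∞) ↔ H.edist p.2 b ≤ (N : ℕ∞)) := fun {T a b p} hp hT =>
      hT.edist_iff (q := (a, b)) (Set.mem_insert_of_mem _ hp) (Set.mem_insert _ _) le_rfl
    refine ⟨h.atom.union h'.atom (fun p hp q hq hd => hG p hp q hq (edist_le_mono _ hd hN))
      (fun p hp q hq hd => hH p hp q hq (edist_le_mono _ hd hN)), ?_, ?_⟩
    · rintro a ⟨p, hp | hp, ha⟩
      · obtain ⟨b, hb⟩ := h.2.1 a ⟨p, hp, ha⟩
        exact ⟨b, key a b ⟨p, hp, ha, (near hp hb).1 ha⟩ hb⟩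
      · obtain ⟨b, hb⟩ := h'.2.1 a ⟨p, hp, ha⟩
        exact ⟨b, key' a b ⟨p, hp, ha, (near hp hb).1 ha⟩ hb⟩
    · rintro b ⟨p, hp | hp, hb⟩
      · obtain ⟨a, ha⟩ := h.2.2 b ⟨p, hp, hb⟩
        exact ⟨a, key a b ⟨p, hp, (near hp ha).2 hb, hb⟩ ha⟩
      · obtain ⟨a, ha⟩ := h'.2.2 b ⟨p, hp, hb⟩
        exact ⟨a, key' a b ⟨p, hp, (near hp ha).2 hb, hb⟩ ha⟩

/-- The vertices within distance `(n + 1) * N` of a position determine its local equivalence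
class. -/
theorem LocalEquiv.induce (G : SimpleGraph V) (P : S → Set V) (N n : ℕ) (A : Set V) (X : Set A)
    (hA : ∀ x ∈ X, ∀ z, G.edist (x : V) z ≤ (((n + 1) * N : ℕ) : ℕ∞) → z ∈ A) :
    LocalEquiv G P (G.induce A) (fun s => {w : A | (w : V) ∈ P s}) N n
      ((fun x : A => ((x : V), x)) '' X) := by
  have atom : ∀ X : Set A, (∀ x ∈ X, ∀ z, G.edist (x : V) z ≤ (N : ℕ∞) → z ∈ A) →
      AtomEquiv G P (G.induce A) (fun s => {w : A | (w : V) ∈ P s}) N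
        ((fun x : A => ((x : V), x)) '' X) := by
    intro X hA
    refine ⟨?_, ?_⟩
    · rintro _ ⟨x, hx, rfl⟩ _ ⟨y, hy, rfl⟩ d hd
      exact (edist_induce_le_iff G A x y d
        (fun z hz => hA x hx z (edist_le_mono _ hz hd))).symm
    · rintro _ ⟨x, hx, rfl⟩ s
      exact Iff.rfl
  induction n generalizing X with
  | zero => exact atom X (by simpa using hA)
  | succ n ih =>
    have hle : N ≤ (n + 1 + 1) * N := Nat.le_mul_of_pos_left _ (by omega)
    have hle' : N + (n + 1) * N ≤ (n + 1 + 1) * N := by nlinarith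
    have step : ∀ a : A, (∃ x ∈ X, G.edist (x : V) a ≤ (N : ℕ∞)) →
        LocalEquiv G P (G.induce A) (fun s => {w : A | (w : V) ∈ P s}) N n
          (insert ((a : V), a) ((fun x : A => ((x : V), x)) '' X)) := by
      rintro a ⟨x, hx, hxa⟩
      rw [← Set.image_insert_eq (f := fun x : A => ((x : V), x))]
      refine ih _ ?_
      rintro y (rfl | hy) z hz
      · exact hA x hx z (edist_le_mono _ (edist_le_add _ hxa hz) hle')
      · exact hA y hy z (edist_le_mono _ hz (by nlinarith))
    refine ⟨atom X fun x hx z hz => hA x hx z (edist_le_mono _ hz hle), ?_, ?_⟩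
    · rintro a ⟨_, ⟨x, hx, rfl⟩, ha⟩
      exact ⟨⟨a, hA x hx a (edist_le_mono _ ha hle)⟩,
        step ⟨a, hA x hx a (edist_le_mono _ ha hle)⟩ ⟨x, hx, ha⟩⟩
    · rintro b ⟨_, ⟨x, hx, rfl⟩, hb⟩
      exact ⟨b, step b ⟨x, hx, edist_le_of_edist_induce_le _ _ _ _ _ hb⟩⟩

end BackForth

/-! ### Local types -/

section LocalTypes

/-- Truncated distances and colours of a `k`-tuple. -/
abbrev AtomType (S : Type) (N k : ℕ) : Type :=
  (Fin k → Fin k → Fin (N + 1) → Prop) × (Fin k → S → Prop)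

/-- The possible local types, of radius `N` and rank `n`, of `k`-tuples of vertices in `S`-expanded
graphs: the atomic type, and the set of local types of rank `n - 1` of the extensions of the tuple
by a vertex at distance at most `N`. -/
def LocalType (S : Type) (N : ℕ) : ℕ → ℕ → Type
  | 0, k => AtomType S N k
  | n + 1, k => AtomType S N k × Set (LocalType S N n (k + 1))

instance LocalType.finite (S : Type) [Finite S] (N n k : ℕ) : Finite (LocalType S N n k) := by
  induction n generalizing k with
  | zero => exact inferInstanceAs (Finite (AtomType S N k))
  | succ n ih =>
    have := ih (k + 1)
    exact inferInstanceAs (Finite (AtomType S N k × Set (LocalType S N n (k + 1))))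

variable {S : Type} {V W : Type u}

/-- The truncated distances and colours of the tuple `v`. -/
def atomType (G : SimpleGraph V) (P : S → Set V) (N : ℕ) {k : ℕ} (v : Fin k → V) :
    AtomType S N k :=
  (fun i j d => G.edist (v i) (v j) ≤ ((d : ℕ) : ℕ∞), fun i s => v i ∈ P s)

/-- The local type of radius `N` and rank `n` of the tuple `v`. -/
def localType (G : SimpleGraph V) (P : S → Set V) (N : ℕ) :
    (n : ℕ) → {k : ℕ} → (Fin k → V) → LocalType S N n k
  | 0, _, v => atomType G P N v
  | n + 1, _, v => (atomType G P N v,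
      {t | ∃ a, (∃ i, G.edist (v i) a ≤ (N : ℕ∞)) ∧ localType G P N n (Fin.snoc v a) = t})

variable (G : SimpleGraph V) (P : S → Set V) (H : SimpleGraph W) (Q : S → Set W) (N n : ℕ)

theorem atomEquiv_range_iff {k : ℕ} (v : Fin k → V) (w : Fin k → W) :
    AtomEquiv G P H Q N (Set.range fun i => (v i, w i)) ↔
      atomType G P N v = atomType H Q N w := by
  simp only [AtomEquiv, Set.forall_mem_range, atomType, Prod.mk.injEq, funext_iff, eq_iff_iff]
  refine and_congr_left' ⟨fun h i j d => h i j d (by omega), fun h i j d hd => ?_⟩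
  exact h i j ⟨d, by omega⟩

theorem range_snoc_pair {k : ℕ} (v : Fin k → V) (w : Fin k → W) (a : V) (b : W) :
    (Set.range fun i : Fin (k + 1) =>
      ((Fin.snoc v a : Fin (k + 1) → V) i, (Fin.snoc w b : Fin (k + 1) → W) i)) =
      insert (a, b) (Set.range fun i => (v i, w i)) := by
  ext p
  simp only [Set.mem_range, Set.mem_insert_iff, Fin.exists_fin_succ', Fin.snoc_castSucc,
    Fin.snoc_last]
  rw [or_comm, eq_comm (b := p)]

/-- Tuples are locally equivalent exactly if they have the same local type. -/
theorem localEquiv_range_iff {k : ℕ} (v : Fin k → V) (w : Fin k → W) :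
    LocalEquiv G P H Q N n (Set.range fun i => (v i, w i)) ↔
      localType G P N n v = localType H Q N n w := by
  induction n generalizing k with
  | zero => exact atomEquiv_range_iff G P H Q N v w
  | succ n ih =>
    simp only [LocalEquiv, localType, atomEquiv_range_iff, Set.exists_range_iff,
      ← range_snoc_pair, ih]
    refine Iff.trans (and_congr_right fun h0 => ?_) Prod.mk_inj.symm
    have near : ∀ a b, localType G P N n (Fin.snoc v a : Fin (k + 1) → V) =
        localType H Q N n (Fin.snoc w b : Fin (k + 1) → W) → ∀ i,
        (G.edist (v i) a ≤ (N : ℕ∞) ↔ H.edist (w i) b ≤ (N : ℕ∞)) := by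
      intro a b hab i
      rw [← ih, range_snoc_pair] at hab
      exact hab.edist_iff (p := (v i, w i)) (q := (a, b))
        (Set.mem_insert_of_mem _ ⟨i, rfl⟩) (Set.mem_insert _ _) le_rfl
    constructor
    · rintro ⟨h1, h2⟩
      ext t
      constructor
      · rintro ⟨a, ⟨i, ha⟩, rfl⟩
        obtain ⟨b, hb⟩ := h1 a ⟨i, ha⟩
        exact ⟨b, ⟨i, (near a b hb i).1 ha⟩, hb.symm⟩
      · rintro ⟨b, ⟨i, hb⟩, rfl⟩
        obtain ⟨a, ha⟩ := h2 b ⟨i, hb⟩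
        exact ⟨a, ⟨i, (near a b ha i).2 hb⟩, ha⟩
    · intro h
      refine ⟨fun a ha => ?_, fun b hb => ?_⟩
      · obtain ⟨b, -, hb⟩ := h.subset ⟨a, ha, rfl⟩
        exact ⟨b, hb.symm⟩
      · obtain ⟨a, -, ha⟩ := h.superset ⟨b, hb, rfl⟩
        exact ⟨a, ha⟩

/-- The local type of a tuple does not change in an induced subgraph that contains the ball of
radius `(n + 1) * N` around the tuple. -/
theorem localType_induce (A : Set V) {k : ℕ} (v : Fin k → V) (hv : ∀ i, v i ∈ A)
    (hA : ∀ i z, G.edist (v i) z ≤ (((n + 1) * N : ℕ) : ℕ∞) → z ∈ A) :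
    localType (G.induce A) (fun s => {w : A | (w : V) ∈ P s}) N n (fun i => ⟨v i, hv i⟩) =
      localType G P N n v := by
  rw [eq_comm, ← localEquiv_range_iff]
  refine (LocalEquiv.induce G P N n A (Set.range fun i => (⟨v i, hv i⟩ : A)) ?_).mono_subset
    le_rfl ?_
  · rintro _ ⟨i, rfl⟩ z hz
    exact hA i z hz
  · rintro _ ⟨i, rfl⟩
    exact ⟨_, ⟨i, rfl⟩, rfl⟩

end LocalTypes

/-! ### First-order formulas are invariant under local equivalence in a fixed structure -/

section Invariance

variable {S : Type} {V W : Type u}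

theorem LocalEquiv.symm {G : SimpleGraph V} {P : S → Set V} {H : SimpleGraph W} {Q : S → Set W}
    {N n : ℕ} {R : Set (V × W)} (h : LocalEquiv G P H Q N n R) :
    LocalEquiv H Q G P N n (Prod.swap ⁻¹' R) := by
  have atom : ∀ {R : Set (V × W)}, AtomEquiv G P H Q N R →
      AtomEquiv H Q G P N (Prod.swap ⁻¹' R) := fun h =>
    ⟨fun p hp q hq d hd => (h.1 _ hp _ hq d hd).symm, fun p hp s => (h.2 _ hp s).symm⟩
  induction n generalizing R with
  | zero => exact atom h
  | succ n ih =>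
    refine ⟨atom h.atom, ?_, ?_⟩
    · rintro b ⟨p, hp, hb⟩
      obtain ⟨a, ha⟩ := h.2.2 b ⟨_, hp, hb⟩
      refine ⟨a, (ih ha).mono_subset le_rfl ?_⟩
      rintro q (rfl | hq)
      · exact Or.inl rfl
      · exact Or.inr hq
    · rintro a ⟨p, hp, ha⟩
      obtain ⟨b, hb⟩ := h.2.1 a ⟨_, hp, ha⟩
      refine ⟨b, (ih hb).mono_subset le_rfl ?_⟩
      rintro q (rfl | hq)
      · exact Or.inl rfl
      · exact Or.inr hq

theorem localEquiv_singleton_iff (G : SimpleGraph V) (P : S → Set V) (H : SimpleGraph W)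
    (Q : S → Set W) (N n : ℕ) (a : V) (b : W) :
    LocalEquiv G P H Q N n {(a, b)} ↔ localType G P N n ![a] = localType H Q N n ![b] := by
  rw [← localEquiv_range_iff]
  simp

variable (G : SimpleGraph V) (P : S → Set V)

/-- Finitely many vertices near a position can be answered one after the other. -/
theorem LocalEquiv.exists_answers {N n D : ℕ} {R : Set (V × V)} (hD : D ≤ N) {m : ℕ}
    (h : LocalEquiv G P G P N (n + m) R) (y : Fin m → V)
    (hy : ∀ i, ∃ p ∈ R, G.edist p.2 (y i) ≤ (D : ℕ∞)) :
    ∃ z : Fin m → V, LocalEquiv G P G P N n (R ∪ Set.range fun i => (z i, y i)) := by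
  induction m generalizing R with
  | zero => exact ⟨Fin.elim0, by simpa using h⟩
  | succ m ih =>
    obtain ⟨p, hp, hpy⟩ := hy (Fin.last m)
    obtain ⟨a, ha⟩ := h.2.2 (y (Fin.last m)) ⟨p, hp, edist_le_mono _ hpy hD⟩
    obtain ⟨z, hz⟩ := ih ha (fun i => y i.castSucc) (fun i => by
      obtain ⟨q, hq, hqy⟩ := hy i.castSucc
      exact ⟨q, Set.mem_insert_of_mem _ hq, hqy⟩)
    refine ⟨Fin.snoc z a, hz.mono_subset le_rfl ?_⟩
    rintro q (hq | ⟨i, rfl⟩)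
    · exact Or.inl (Or.inr hq)
    · induction i using Fin.lastCases with
      | last => exact Or.inl (Or.inl (by simp))
      | cast i => exact Or.inr ⟨i, by simp⟩

/-- In a fixed structure, a position that is good enough for the local game can be extended by any
vertex `a` of the structure. A vertex `a` far from the position `R` is answered by a vertex of the
same local type far from the other side of `R`. If there were none, all vertices of this type would
be within distance `D` of the right-hand side; then, starting from a set of such vertices scattered
around the left-hand side, one could add `a` and move the new set back to the left-hand side, and so
obtain arbitrarily large scattered sets around the few vertices there. Here `D = (2 * L + 1) * N`;
the `K + 1` additional rounds serve to move a scattered set, and the radius exceeds `3 * D` so that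
`a` is at distance more than `2 * D` from all vertices around the left-hand side. -/
theorem LocalEquiv.exists_insert (N L K : ℕ) {R : Set (V × V)} (hR : R.encard ≤ K)
    (h : LocalEquiv G P G P (3 * ((2 * L + 1) * N) + N) (L + (K + 1)) R) (a : V) :
    ∃ b, LocalEquiv G P G P N L (insert (a, b) R) := by
  -- Positions at distance more than `D` do not interfere, by `LocalEquiv.union`.
  obtain ⟨D, hD⟩ : ∃ D, D = (2 * L + 1) * N := ⟨_, rfl⟩
  rw [← hD] at h
  have hND : N ≤ 3 * D + N := by omega
  have hLL : L ≤ L + (K + 1) := by omega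
  by_cases hnear : ∃ p ∈ R, G.edist p.1 a ≤ ((3 * D + N : ℕ) : ℕ∞)
  · obtain ⟨b, hb⟩ := LocalEquiv.mono (n := L + 1) h le_rfl (by omega) le_rfl |>.2.1 a hnear
    exact ⟨b, hb.mono hND le_rfl le_rfl⟩
  by_contra hno
  push Not at hnear hno
  have hcov : ∀ b, LocalEquiv G P G P N L {(a, b)} →
      ∃ p ∈ R, G.edist p.2 b ≤ (D : ℕ∞) := by
    intro b hb
    by_contra hfar
    push Not at hfar
    refine hno b ?_
    rw [Set.insert_eq, Set.union_comm]
    refine (h.mono hND hLL le_rfl).union hb ?_ ?_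
    · rintro p hp _ rfl hd
      rw [← hD] at hd
      exact (hnear p hp).not_ge (edist_le_mono _ hd (by omega))
    · rintro p hp _ rfl hd
      rw [← hD] at hd
      exact (hfar p hp).not_ge hd
  have scattered : ∀ m ≤ K + 1, ∃ x : Fin m → V, (∀ i, LocalEquiv G P G P N L {(a, x i)}) ∧
      (∀ i, ∃ p ∈ R, G.edist p.1 (x i) ≤ (D : ℕ∞)) ∧
      ∀ i j, i ≠ j → ¬ G.edist (x i) (x j) ≤ ((D + D : ℕ) : ℕ∞) := by
    intro m hm
    induction m with
    | zero => exact ⟨Fin.elim0, fun i => i.elim0, fun i => i.elim0, fun i => i.elim0⟩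
    | succ m ih =>
      obtain ⟨x, hxa, hxR, hxx⟩ := ih (by omega)
      have hfar : ∀ i, ¬ G.edist (x i) a ≤ ((D + D : ℕ) : ℕ∞) := by
        intro i hi
        obtain ⟨p, hp, hpx⟩ := hxR i
        exact (hnear p hp).not_ge (edist_le_mono _ (edist_le_add _ hpx hi) (by omega))
      obtain ⟨y, hy⟩ : ∃ y : Fin (m + 1) → V, y = Fin.snoc x a := ⟨_, rfl⟩
      have hya : ∀ i, LocalEquiv G P G P N L {(a, y i)} := by
        intro i
        rw [hy]
        induction i using Fin.lastCases with
        | last => rw [Fin.snoc_last, localEquiv_singleton_iff]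
        | cast i => rw [Fin.snoc_castSucc]; exact hxa i
      have hyy : ∀ i j, i ≠ j → ¬ G.edist (y i) (y j) ≤ ((D + D : ℕ) : ℕ∞) := by
        intro i j hij
        rw [hy]
        induction i using Fin.lastCases with
        | last =>
          induction j using Fin.lastCases with
          | last => exact absurd rfl hij
          | cast j =>
            rw [Fin.snoc_last, Fin.snoc_castSucc, SimpleGraph.edist_comm]; exact hfar j
        | cast i =>
          induction j using Fin.lastCases with
          | last => rw [Fin.snoc_last, Fin.snoc_castSucc]; exact hfar i
          | cast j =>
            rw [Fin.snoc_castSucc, Fin.snoc_castSucc]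
            exact hxx i j fun h => hij (h ▸ rfl)
      obtain ⟨z, hz⟩ := LocalEquiv.exists_answers G P (N := 3 * D + N) (n := L) (D := D)
        (by omega) (h.mono (n := L + (m + 1)) le_rfl (by omega) le_rfl) y
        (fun i => hcov _ (hya i))
      have hmem : ∀ i, (z i, y i) ∈ R ∪ Set.range fun i => (z i, y i) := fun i => Or.inr ⟨i, rfl⟩
      refine ⟨z, fun i => ?_, fun i => ?_, fun i j hij hd => ?_⟩
      · have h1 := hya i
        have h2 : LocalEquiv G P G P N L {(z i, y i)} :=
          hz.mono hND le_rfl (Set.singleton_subset_iff.2 (hmem i))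
        rw [localEquiv_singleton_iff] at h1 h2 ⊢
        rw [h1, h2]
      · obtain ⟨p, hp, hpy⟩ := hcov _ (hya i)
        exact ⟨p, hp, (hz.edist_iff (Or.inl hp) (hmem i) (by omega)).2 hpy⟩
      · exact hyy i j hij ((hz.edist_iff (hmem i) (hmem j) (by omega)).1 hd)
  -- Two of `K + 1` scattered vertices cannot be close to the same entry of the position.
  obtain ⟨x, -, hxR, hxx⟩ := scattered (K + 1) le_rfl
  choose p hp hpx using hxR
  have hinj : Function.Injective p := by
    intro i j hij
    by_contra hne
    refine hxx i j hne (edist_le_add _ (y := (p i).1) ?_ ?_)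
    · rw [SimpleGraph.edist_comm]; exact hpx i
    · rw [hij]; exact hpx j
  have hcard := Set.encard_le_encard (Set.range_subset_iff.2 hp)
  rw [← Set.image_univ, hinj.encard_image, Set.encard_univ,
    ENat.card_eq_coe_fintype_card, Fintype.card_fin] at hcard
  have := hcard.trans hR
  norm_cast at this
  omega

open FirstOrder Language

/-- Within a single structure, each formula is invariant under a suitable local equivalence. Its
parameters `N` and `L` are the same for all structures. Between different structures there is no
such invariance, since local equivalence does not determine the truth of sentences. -/
theorem exists_realize_iff_of_localEquiv {α : Type} {n : ℕ}
    (φ : (expLang S).BoundedFormula α n) (K : ℕ) :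
    ∃ N L : ℕ, ∀ (V : Type u) (G : SimpleGraph V) (P : S → Set V) (R : Set (V × V)),
      R.encard ≤ K → LocalEquiv G P G P N L R →
      ∀ (v w : α → V) (xs ys : Fin n → V), (∀ i, (v i, w i) ∈ R) → (∀ i, (xs i, ys i) ∈ R) →
      letI := expStructure G P
      (φ.Realize v xs ↔ φ.Realize w ys) := by
  have term : ∀ {n : ℕ} (t : (expLang S).Term (α ⊕ Fin n)) {V : Type u} (G : SimpleGraph V)
      (P : S → Set V) {R : Set (V × V)} {v w : α → V} {xs ys : Fin n → V},
      (∀ i, (v i, w i) ∈ R) → (∀ i, (xs i, ys i) ∈ R) →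
      letI := expStructure G P
      (t.realize (Sum.elim v xs), t.realize (Sum.elim w ys)) ∈ R := by
    intro n t V G P R v w xs ys hv hx
    cases t with
    | var i => cases i with
      | inl i => exact hv i
      | inr i => exact hx i
    | func f => exact f.elim
  induction φ generalizing K with
  | falsum => exact ⟨0, 0, fun V G P R _ _ v w xs ys _ _ => Iff.rfl⟩
  | equal t₁ t₂ =>
    refine ⟨0, 0, fun V G P R _ h v w xs ys hv hx => ?_⟩
    have := h.edist_iff (d := 0) (term t₁ G P hv hx) (term t₂ G P hv hx) le_rfl
    rw [edist_le_zero_iff, edist_le_zero_iff] at this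
    exact this
  | rel r ts =>
    refine ⟨1, 0, fun V G P R _ h v w xs ys hv hx => ?_⟩
    cases r with
    | adj =>
      have h0 := h.edist_iff (d := 0) (term (ts 0) G P hv hx) (term (ts 1) G P hv hx) (by omega)
      have h1 := h.edist_iff (d := 1) (term (ts 0) G P hv hx) (term (ts 1) G P hv hx) le_rfl
      rw [edist_le_zero_iff, edist_le_zero_iff] at h0
      rw [Nat.cast_one, SimpleGraph.edist_le_one_iff_adj_or_eq,
        SimpleGraph.edist_le_one_iff_adj_or_eq] at h1
      refine Iff.trans (b := G.Adj _ _) Iff.rfl (Iff.trans ?_ (Iff.rfl (a := G.Adj _ _)))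
      constructor
      · intro hadj
        exact (h1.1 (Or.inl hadj)).resolve_right fun h => hadj.ne (h0.2 h)
      · intro hadj
        exact (h1.2 (Or.inl hadj)).resolve_right fun h => hadj.ne (h0.1 h)
    | unary s => exact h.atom.2 _ (term (ts 0) G P hv hx) s
  | imp φ ψ ihφ ihψ =>
    obtain ⟨N, L, h⟩ := ihφ K
    obtain ⟨N', L', h'⟩ := ihψ K
    refine ⟨max N N', max L L', fun V G P R hK hR v w xs ys hv hx => ?_⟩
    exact imp_congr
      (h V G P R hK (hR.mono (le_max_left _ _) (le_max_left _ _) le_rfl) v w xs ys hv hx)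
      (h' V G P R hK (hR.mono (le_max_right _ _) (le_max_right _ _) le_rfl) v w xs ys hv hx)
  | @all n φ ih =>
    obtain ⟨N, L, h⟩ := ih (K + 1)
    -- One direction suffices, since local equivalence is symmetric.
    have key : ∀ (V : Type u) (G : SimpleGraph V) (P : S → Set V) (R : Set (V × V)),
        R.encard ≤ K →
        LocalEquiv G P G P (3 * ((2 * L + 1) * N) + N) (L + (K + 1)) R →
        ∀ (v w : α → V) (xs ys : Fin n → V), (∀ i, (v i, w i) ∈ R) →
        (∀ i, (xs i, ys i) ∈ R) →
        letI := expStructure G P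
        φ.all.Realize w ys → φ.all.Realize v xs := by
      intro V G P R hK hR v w xs ys hv hx hall a
      obtain ⟨b, hb⟩ := hR.exists_insert G P N L K hK a
      refine (h V G P _ ((Set.encard_insert_le _ _).trans ?_) hb v w (Fin.snoc xs a)
        (Fin.snoc ys b) (fun i => Or.inr (hv i)) ?_).2 (hall b)
      · push_cast
        exact add_le_add_left hK 1
      · intro i
        induction i using Fin.lastCases with
        | last => exact Or.inl (by simp)
        | cast i => exact Or.inr (by simpa using hx i)
    refine ⟨_, _, fun V G P R hK hR v w xs ys hv hx => ⟨?_, key V G P R hK hR v w xs ys hv hx⟩⟩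
    refine key V G P (Prod.swap ⁻¹' R) ?_ hR.symm w v ys xs hv hx
    rwa [Set.encard_preimage_of_bijective Prod.swap_bijective]

end Invariance

/-! ### Relations expressible by formulas -/

section Expressible

variable {S : Type} {α β : Type}

/-- A relation on `α`-indexed tuples of vertices, given for all `S`-expanded graphs. -/
abbrev VertexRel (S α : Type) : Type (u + 1) :=
  ∀ V : Type u, SimpleGraph V → (S → Set V) → (α → V) → Prop

/-- The relation `Q` is defined by a single formula in all `S`-expanded graphs. -/
def Expressible (Q : VertexRel.{u} S α) : Prop :=
  ∃ φ : (expLang S).Formula α, ∀ (V : Type u) (G : SimpleGraph V) (P : S → Set V) (v : α → V),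
    letI := expStructure G P
    φ.Realize v ↔ Q V G P v

namespace Expressible

open FirstOrder Language

variable {Q Q' : VertexRel.{u} S α}

theorem congr (h : Expressible Q) (hQ : ∀ V G P v, Q V G P v ↔ Q' V G P v) : Expressible Q' := by
  obtain ⟨φ, hφ⟩ := h
  exact ⟨φ, fun V G P v => (hφ V G P v).trans (hQ V G P v)⟩

theorem const (p : Prop) : Expressible (S := S) (α := α) (fun _ _ _ _ => p) := by
  by_cases hp : p
  · refine ⟨⊤, fun V G P v => ?_⟩
    let _ := expStructure G P
    simp [hp]
  · refine ⟨⊥, fun V G P v => ?_⟩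
    let _ := expStructure G P
    simp [hp]

theorem not (h : Expressible Q) : Expressible (fun V G P v => ¬ Q V G P v) := by
  obtain ⟨φ, hφ⟩ := h
  exact ⟨φ.not, fun V G P v => not_congr (hφ V G P v)⟩

theorem imp (h : Expressible Q) (h' : Expressible Q') :
    Expressible (fun V G P v => Q V G P v → Q' V G P v) := by
  obtain ⟨φ, hφ⟩ := h
  obtain ⟨ψ, hψ⟩ := h'
  exact ⟨φ.imp ψ, fun V G P v => imp_congr (hφ V G P v) (hψ V G P v)⟩

theorem and (h : Expressible Q) (h' : Expressible Q') :
    Expressible (fun V G P v => Q V G P v ∧ Q' V G P v) :=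
  (h.imp h'.not).not.congr fun V G P v => by tauto

theorem or (h : Expressible Q) (h' : Expressible Q') :
    Expressible (fun V G P v => Q V G P v ∨ Q' V G P v) :=
  (h.not.imp h').congr fun V G P v => by tauto

theorem iff (h : Expressible Q) (h' : Expressible Q') :
    Expressible (fun V G P v => Q V G P v ↔ Q' V G P v) :=
  ((h.imp h').and (h'.imp h)).congr fun V G P v => by tauto

theorem adj (i j : α) : Expressible (S := S) (fun _ G _ v => G.Adj (v i) (v j)) :=
  ⟨(symE S).formula₂ (Term.var i) (Term.var j), fun V G P v => by
    let _ := expStructure G P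
    exact Formula.realize_rel₂⟩

theorem eq (i j : α) : Expressible (S := S) (fun _ _ _ v => v i = v j) :=
  ⟨(Term.var i).equal (Term.var j), fun V G P v => by
    let _ := expStructure G P
    exact Formula.realize_equal⟩

theorem mem (s : S) (i : α) : Expressible (S := S) (fun _ _ P v => v i ∈ P s) :=
  ⟨(symU s).formula₁ (Term.var i), fun V G P v => by
    let _ := expStructure G P
    exact Formula.realize_rel₁⟩

theorem comp (h : Expressible Q) (f : α → β) : Expressible (fun V G P v => Q V G P (v ∘ f)) := by
  obtain ⟨φ, hφ⟩ := h
  refine ⟨φ.relabel f, fun V G P v => ?_⟩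
  let _ := expStructure G P
  rw [Formula.realize_relabel]
  exact hφ V G P _

theorem forall_finite {ι : Type} [Finite ι] {Q : ι → VertexRel.{u} S α}
    (h : ∀ i, Expressible (Q i)) : Expressible (fun V G P v => ∀ i, Q i V G P v) := by
  choose φ hφ using h
  refine ⟨Formula.iInf φ, fun V G P v => ?_⟩
  let _ := expStructure G P
  rw [Formula.realize_iInf]
  exact forall_congr' fun i => hφ i V G P v

theorem exists_finite {ι : Type} [Finite ι] {Q : ι → VertexRel.{u} S α}
    (h : ∀ i, Expressible (Q i)) : Expressible (fun V G P v => ∃ i, Q i V G P v) :=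
  (forall_finite fun i => (h i).not).not.congr fun V G P v => by simp

/-- Quantification over vertices; the new variable is `none`. -/
theorem exists_vertex {Q : ∀ V : Type u, SimpleGraph V → (S → Set V) → (α → V) → V → Prop}
    (h : Expressible (α := Option α) fun V G P v => Q V G P (fun i => v (some i)) (v none)) :
    Expressible (fun V G P v => ∃ a, Q V G P v a) := by
  obtain ⟨φ, hφ⟩ := h
  refine ⟨(φ.relabel (fun o : Option α => o.elim (Sum.inr ()) Sum.inl)).iExs Unit,
    fun V G P v => ?_⟩
  let _ := expStructure G P
  rw [Formula.realize_iExs]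
  have : ∀ a : Unit → V, (φ.relabel (fun o : Option α => o.elim (Sum.inr ()) Sum.inl)).Realize
      (Sum.elim v a) ↔ Q V G P v (a ()) := by
    intro a
    rw [Formula.realize_relabel]
    exact hφ V G P _
  simp only [this]
  exact ⟨fun ⟨a, ha⟩ => ⟨_, ha⟩, fun ⟨a, ha⟩ => ⟨fun _ => a, ha⟩⟩

theorem forall_vertex {Q : ∀ V : Type u, SimpleGraph V → (S → Set V) → (α → V) → V → Prop}
    (h : Expressible (α := Option α) fun V G P v => Q V G P (fun i => v (some i)) (v none)) :
    Expressible (fun V G P v => ∀ a, Q V G P v a) :=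
  (exists_vertex (Q := fun V G P v a => ¬ Q V G P v a) h.not).not.congr fun V G P v => by simp

theorem edist_le (d : ℕ) (i j : α) :
    Expressible (S := S) (fun _ G _ v => G.edist (v i) (v j) ≤ (d : ℕ∞)) := by
  induction d generalizing α with
  | zero => exact (eq i j).congr fun V G P v => (edist_le_zero_iff G _ _).symm
  | succ d ih =>
    refine congr (Q := fun V G P v => ∃ z, G.edist (v i) z ≤ (d : ℕ∞) ∧ (z = v j ∨ G.Adj z (v j)))
      (exists_vertex ?_) fun V G P v => (edist_le_succ_iff G _ _ d).symm
    exact (ih (some i) none).and ((eq none (some j)).or (adj none (some j)))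

theorem atomType_eq [Finite S] (N k : ℕ) (t : AtomType S N k) :
    Expressible (fun _ G P v => atomType G P N v = t) := by
  refine congr (Q := fun V G P v => (∀ i j : Fin k, ∀ d : Fin (N + 1),
    (G.edist (v i) (v j) ≤ ((d : ℕ) : ℕ∞) ↔ t.1 i j d)) ∧ ∀ i s, (v i ∈ P s ↔ t.2 i s))
    ?_ fun V G P v => ?_
  · exact (forall_finite fun i => forall_finite fun j => forall_finite fun d : Fin (N + 1) =>
      (edist_le d i j).iff (const _)).and
      (forall_finite fun i => forall_finite fun s => (mem s i).iff (const _))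
  · obtain ⟨t₁, t₂⟩ := t
    simp only [atomType, Prod.mk.injEq, funext_iff, eq_iff_iff]

theorem localType_eq [Finite S] (N n k : ℕ) (t : LocalType S N n k) :
    Expressible (fun _ G P v => localType G P N n v = t) := by
  induction n generalizing k with
  | zero => exact atomType_eq N k t
  | succ n ih =>
    refine congr (Q := fun V G P v => atomType G P N v = t.1 ∧ ∀ t' : LocalType S N n (k + 1),
      ((∃ a, (∃ i, G.edist (v i) a ≤ (N : ℕ∞)) ∧
        localType G P N n (Fin.snoc v a : Fin (k + 1) → V) = t') ↔ t' ∈ t.2))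
      ((atomType_eq N k _).and (forall_finite fun t' => iff (exists_vertex (and
        (exists_finite fun i => edist_le N (some i) none) ?_)) (const _))) fun V G P v => ?_
    · refine ((ih (k + 1) t').comp (Fin.snoc some none : Fin (k + 1) → Option (Fin k))).congr
        fun V G P v => ?_
      have : v ∘ (Fin.snoc some none : Fin (k + 1) → Option (Fin k)) =
          Fin.snoc (fun i => v (some i)) (v none) := by
        funext i
        induction i using Fin.lastCases <;> simp
      rw [this]
    · obtain ⟨t₁, t₂⟩ := t
      refine Iff.trans (and_congr_right fun _ => ?_) Prod.mk_inj.symm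
      exact Set.ext_iff.symm

/-- Formulas over a structure on a definable set of vertices, with definable relations, can be
translated to the surrounding structure. -/
theorem realize_restrict {T : Type} [Finite α]
    {ν : ∀ V : Type u, SimpleGraph V → (S → Set V) → V → Prop}
    (H : ∀ (V : Type u) (G : SimpleGraph V) (P : S → Set V), SimpleGraph {x // ν V G P x})
    (C : ∀ (V : Type u) (G : SimpleGraph V) (P : S → Set V), T → Set {x // ν V G P x})
    (hν : Expressible (α := Fin 1) fun V G P v => ν V G P (v 0))
    (hH : Expressible (α := Fin 2) fun V G P v =>
      ∃ h₀ h₁, (H V G P).Adj ⟨v 0, h₀⟩ ⟨v 1, h₁⟩)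
    (hC : ∀ t, Expressible (α := Fin 1) fun V G P v => ∃ h, ⟨v 0, h⟩ ∈ C V G P t)
    {n : ℕ} (φ : (expLang T).BoundedFormula α n) :
    Expressible (α := α ⊕ Fin n) fun V G P v => ∃ h : ∀ i, ν V G P (v i),
      letI := expStructure (H V G P) (C V G P)
      φ.Realize (M := {x // ν V G P x}) (fun i => ⟨v (.inl i), h _⟩)
        (fun i => ⟨v (.inr i), h _⟩) := by
  have hν' : ∀ {γ : Type} (i : γ), Expressible fun V G P v => ν V G P (v i) := fun i =>
    hν.comp fun _ => i
  have hall : ∀ {γ : Type} [Finite γ], Expressible (α := γ) fun V G P v => ∀ i, ν V G P (v i) :=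
    forall_finite hν'
  have term : ∀ {n : ℕ} (t : (expLang T).Term (α ⊕ Fin n)), ∃ i, t = Term.var i := by
    intro n t
    cases t with
    | var i => exact ⟨i, rfl⟩
    | func f => exact f.elim
  have value : ∀ {n : ℕ} (i : α ⊕ Fin n) (V : Type u) (G : SimpleGraph V) (P : S → Set V)
      (v : α ⊕ Fin n → V) (h : ∀ i, ν V G P (v i)),
      (Sum.elim (fun i => (⟨v (.inl i), h _⟩ : {x // ν V G P x}))
        (fun i => (⟨v (.inr i), h _⟩ : {x // ν V G P x}))) i =
        ⟨v i, h i⟩ := by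
    rintro n (i | i) V G P v h <;> rfl
  induction φ with
  | falsum => exact (const False).congr fun V G P v => ⟨fun h => h.elim, fun ⟨_, h⟩ => h⟩
  | equal t₁ t₂ =>
    obtain ⟨i, rfl⟩ := term t₁
    obtain ⟨j, rfl⟩ := term t₂
    refine (hall.and (eq i j)).congr fun V G P v => ?_
    rw [← exists_prop]
    refine exists_congr fun h => ?_
    let _ := expStructure (H V G P) (C V G P)
    refine Iff.trans ?_ (Iff.rfl (a := (Term.var (L := expLang T) i).realize _ =
      (Term.var (L := expLang T) j).realize _))
    rw [Term.realize_var, Term.realize_var, value i, value j, Subtype.mk.injEq]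
  | rel r ts =>
    cases r with
    | adj =>
      obtain ⟨i, hi⟩ := term (ts 0)
      obtain ⟨j, hj⟩ := term (ts 1)
      refine (hall.and (hH.comp ![i, j])).congr fun V G P v => ?_
      rw [← exists_prop]
      refine exists_congr fun h => ?_
      let _ := expStructure (H V G P) (C V G P)
      refine Iff.trans ?_ (Iff.rfl (a := (H V G P).Adj ((ts 0).realize _) ((ts 1).realize _)))
      rw [hi, hj, Term.realize_var, Term.realize_var, value i, value j]
      exact ⟨fun ⟨_, _, h⟩ => h, fun h' => ⟨h i, h j, h'⟩⟩
    | unary s =>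
      obtain ⟨i, hi⟩ := term (ts 0)
      refine (hall.and ((hC s).comp ![i])).congr fun V G P v => ?_
      rw [← exists_prop]
      refine exists_congr fun h => ?_
      let _ := expStructure (H V G P) (C V G P)
      refine Iff.trans ?_ (Iff.rfl (a := (ts 0).realize _ ∈ C V G P s))
      rw [hi, Term.realize_var, value i]
      exact ⟨fun ⟨_, h⟩ => h, fun h' => ⟨h i, h'⟩⟩
  | imp φ ψ ihφ ihψ =>
    refine (hall.and (ihφ.imp ihψ)).congr fun V G P v => ?_
    rw [← exists_prop]
    refine exists_congr fun h => ?_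
    exact ⟨fun h' h₁ => (h' ⟨h, h₁⟩).2, fun h' ⟨_, h₁⟩ => ⟨h, h' h₁⟩⟩
  | @all n φ ih =>
    obtain ⟨f, hf⟩ : ∃ f : α ⊕ Fin (n + 1) → Option (α ⊕ Fin n),
      f = Sum.elim (fun i => some (.inl i)) (Fin.snoc (fun i => some (.inr i)) none) := ⟨_, rfl⟩
    have hfl : ∀ i, f (.inl i) = some (.inl i) := fun i => by rw [hf]; rfl
    have hfr : ∀ i : Fin n, f (.inr i.castSucc) = some (.inr i) := fun i => by
      rw [hf]; simp
    have hfn : f (.inr (Fin.last n)) = none := by rw [hf]; simp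
    refine (hall.and (forall_vertex (Q := fun V G P v a => ν V G P a →
      ∃ h : ∀ i, ν V G P (((fun o : Option (α ⊕ Fin n) => o.elim a v) ∘ f) i),
      letI := expStructure (H V G P) (C V G P)
      φ.Realize (M := {x // ν V G P x})
        (fun i => ⟨((fun o : Option (α ⊕ Fin n) => o.elim a v) ∘ f) (.inl i), h _⟩)
        (fun i => ⟨((fun o : Option (α ⊕ Fin n) => o.elim a v) ∘ f) (.inr i), h _⟩))
      ((hν' none).imp ((ih.comp f).congr fun V G P v => ?_)))).congr fun V G P v => ?_
    · have : v = fun o : Option (α ⊕ Fin n) => o.elim (v none) (fun i => v (some i)) := by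
        funext o; cases o <;> rfl
      conv_lhs => rw [this]
    · rw [← exists_prop]
      refine exists_congr fun h => ?_
      let _ := expStructure (H V G P) (C V G P)
      have key : ∀ (a : V) (ha : ν V G P a)
          (h' : ∀ i, ν V G P (((fun o : Option (α ⊕ Fin n) => o.elim a v) ∘ f) i)),
          (φ.Realize (M := {x // ν V G P x})
            (fun i => ⟨((fun o : Option (α ⊕ Fin n) => o.elim a v) ∘ f) (.inl i), h' _⟩)
            (fun i => ⟨((fun o : Option (α ⊕ Fin n) => o.elim a v) ∘ f) (.inr i), h' _⟩) ↔
          φ.Realize (M := {x // ν V G P x}) (fun i => ⟨v (.inl i), h _⟩)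
            (Fin.snoc (fun i => ⟨v (.inr i), h _⟩) ⟨a, ha⟩)) := by
        intro a ha h'
        refine iff_of_eq (congrArg₂ _ ?_ ?_)
        · funext i
          exact Subtype.ext (by simp [hfl])
        · funext i
          refine Subtype.ext ?_
          induction i using Fin.lastCases with
          | last => simp [hfn]
          | cast i => simp [hfr]
      constructor
      · rintro h₁ ⟨a, ha⟩
        obtain ⟨h', h₂⟩ := h₁ a ha
        exact (key a ha h').1 h₂
      · intro h₁ a ha
        have h' : ∀ i, ν V G P (((fun o : Option (α ⊕ Fin n) => o.elim a v) ∘ f) i) := by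
          rintro i
          have : ∀ o : Option (α ⊕ Fin n), ν V G P (o.elim a v) := by
            rintro (_ | i)
            exacts [ha, h i]
          exact this _
        exact ⟨h', (key a ha h').2 (h₁ ⟨a, ha⟩)⟩

end Expressible

end Expressible

/-! ### Interpretations from expressible relations -/

section Interpretations

variable {S S' : Type}

open FirstOrder Language in
/-- Expressibility is preserved under renaming the unary symbols and adding further ones. -/
theorem Expressible.reduct {α : Type} {Q : VertexRel.{u} S α} (h : Expressible Q) (f : S → S') :
    Expressible (S := S') (fun V G P v => Q V G (fun s => P (f s)) v) := by
  obtain ⟨φ, hφ⟩ := h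
  let F : expLang S →ᴸ expLang S' :=
    ⟨fun _ f => Empty.elim f, fun _ r => match r with
      | ExpRel.adj => ExpRel.adj
      | ExpRel.unary s => ExpRel.unary (f s)⟩
  refine ⟨F.onFormula φ, fun V G P v => ?_⟩
  let _ := expStructure G (fun s => P (f s))
  let _ := expStructure G P
  have : F.IsExpansionOn V :=
    ⟨fun f => Empty.elim f, fun r _ => by cases r <;> rfl⟩
  rw [LHom.realize_onFormula]
  exact hφ V G _ v

/-- Formulas for `ν` and `η`, where `η` is made symmetric and anti-reflexive. -/
theorem exists_simpleInterpretation
    {ν : ∀ V : Type u, SimpleGraph V → (S → Set V) → V → Prop}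
    {η : ∀ V : Type u, SimpleGraph V → (S → Set V) → V → V → Prop}
    (hν : Expressible (α := Fin 1) fun V G P v => ν V G P (v 0))
    (hη : Expressible (α := Fin 2) fun V G P v => η V G P (v 0) (v 1)) :
    ∃ I : SimpleInterpretation.{u} S,
      (∀ V G P v, Sat G P I.ν v ↔ ν V G P (v 0)) ∧
      ∀ V G P v, Sat G P I.η v ↔ v 0 ≠ v 1 ∧ η V G P (v 0) (v 1) ∧ η V G P (v 1) (v 0) := by
  obtain ⟨φ, hφ⟩ := hν
  obtain ⟨ψ, hψ⟩ := (Expressible.eq (0 : Fin 2) 1).not.and (hη.and (hη.comp ![1, 0]))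
  refine ⟨⟨φ, ψ, fun V G P x y => ?_, fun V G P x y h => ((hψ V G P _).1 h).1⟩, hφ, hψ⟩
  refine (hψ V G P _).trans (Iff.trans ?_ (hψ V G P _).symm)
  exact ⟨fun h => ⟨Ne.symm h.1, h.2.2, h.2.1⟩, fun h => ⟨Ne.symm h.1, h.2.2, h.2.1⟩⟩

end Interpretations

/-! ### Perturbations -/

/-- `x` and `y` lie together in an odd number of the sets in the list. -/
def OddlyTogether {V : Type u} : List (Set V) → V → V → Prop
  | [], _, _ => False
  | M :: l, x, y => Xor (x ∈ M ∧ y ∈ M) (OddlyTogether l x y)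

theorem oddlyTogether_map {V W : Type*} (f : V → W) (l : List (Set W)) (x y : V) :
    OddlyTogether (l.map (f ⁻¹' ·)) x y ↔ OddlyTogether l (f x) (f y) := by
  induction l with
  | nil => exact Iff.rfl
  | cons M l ih => exact iff_of_eq (congrArg (Xor _) (propext ih))

/-- Each symmetric relation on a finite set is obtained from the empty relation by complementing
inside a fixed number of subsets: complementing inside `{a, b}`, `{a}` and `{b}` in total only
affects the pair `a, b`. -/
theorem exists_oddlyTogether_iff (C : Type) [Finite C] :
    ∃ m : ℕ, ∀ R : C → C → Prop, (∀ c d, R c d → R d c) →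
      ∃ l : List (Set C), l.length = m ∧ ∀ c d, OddlyTogether l c d ↔ R c d := by
  classical
  have := Fintype.ofFinite C
  refine ⟨3 * (Finset.univ : Finset (Sym2 C)).toList.length, fun R hR => ?_⟩
  have key : ∀ ps : List (Sym2 C), ps.Nodup → ∃ l : List (Set C), l.length = 3 * ps.length ∧
      ∀ c d, OddlyTogether l c d ↔ R c d ∧ s(c, d) ∈ ps := by
    intro ps hps
    induction ps with
    | nil => exact ⟨[], rfl, fun c d => by simp [OddlyTogether]⟩
    | cons p ps ih =>
      obtain ⟨hp, hps⟩ := List.nodup_cons.1 hps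
      obtain ⟨l, hl, h⟩ := ih hps
      induction p using Sym2.ind with
      | _ a b =>
      by_cases hab : R a b
      · have hR' : ∀ c d, s(c, d) = s(a, b) → R c d := by
          intro c d hcd
          rcases Sym2.eq_iff.1 hcd with ⟨rfl, rfl⟩ | ⟨rfl, rfl⟩
          exacts [hab, hR _ _ hab]
        have flip : ∀ (X : Prop) (c d : C), (X ↔ s(c, d) = s(a, b)) →
            (Xor X (OddlyTogether l c d) ↔ R c d ∧ s(c, d) ∈ s(a, b) :: ps) := by
          intro X c d hX
          rw [h, hX, List.mem_cons]
          by_cases hcd : s(c, d) = s(a, b)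
          · have := hR' c d hcd
            simp [hcd, hp, this]
          · simp [hcd]
        by_cases hne : a = b
        · refine ⟨{a} :: ∅ :: ∅ :: l, by simp [hl]; ring, fun c d => ?_⟩
          rw [← flip (c = a ∧ d = a) c d (by rw [Sym2.eq_iff, ← hne]; tauto)]
          simp [OddlyTogether]
        · refine ⟨{a, b} :: {a} :: {b} :: l, by simp [hl]; ring, fun c d => ?_⟩
          rw [← flip _ c d Iff.rfl, Sym2.eq_iff]
          simp only [OddlyTogether, Set.mem_insert_iff, Set.mem_singleton_iff]
          by_cases hca : c = a <;> by_cases hda : d = a <;> by_cases hcb : c = b <;>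
            by_cases hdb : d = b <;> simp_all [Xor]
      · refine ⟨∅ :: ∅ :: ∅ :: l, by simp [hl]; ring, fun c d => ?_⟩
        simp only [OddlyTogether, Set.mem_empty_iff_false, false_and, xor_false, id, h,
          List.mem_cons]
        have : s(c, d) = s(a, b) → ¬ R c d := by
          intro hcd hc
          rcases Sym2.eq_iff.1 hcd with ⟨rfl, rfl⟩ | ⟨rfl, rfl⟩
          exacts [hab hc, hab (hR _ _ hc)]
        tauto
  obtain ⟨l, hl, h⟩ := key _ (Finset.nodup_toList _)
  exact ⟨l, hl, fun c d => by simp [h]⟩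

theorem iff_xor_and_xor_of_imp {A B E : Prop} (h : ¬ E → (A ↔ B)) : A ↔ Xor (E ∧ Xor A B) B := by
  by_cases hE : E
  · by_cases hA : A <;> by_cases hB : B <;> simp [Xor, hA, hB, hE]
  · simp [Xor, hE, h hE]

/-- Complementing successively inside the sets of the list `l` changes the adjacency of exactly
those pairs that lie together in an odd number of them. -/
theorem stepsProduce_replicate_subsetComplementation {U W : Type u} (l : List (Set U))
    (G : SimpleGraph U) (H : SimpleGraph W) (e : W ≃ U)
    (h : ∀ a b, a ≠ b → (H.Adj a b ↔ Xor (G.Adj (e a) (e b)) (OddlyTogether l (e a) (e b)))) :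
    StepsProduce (List.replicate l.length (Step.nonCopying subsetComplementation)) G H := by
  induction l generalizing G with
  | nil =>
    refine ⟨e, fun {a b} => ?_⟩
    by_cases hab : a = b
    · subst hab; simp
    · rw [h a b hab]; simp [OddlyTogether, Xor]
  | cons M l ih =>
    let K : SimpleGraph U :=
      { Adj := fun x y => x ≠ y ∧ ¬ (G.Adj x y ↔ (x ∈ M ∧ y ∈ M))
        symm := ⟨fun x y h => ⟨h.1.symm, by rw [G.adj_comm, and_comm (a := y ∈ M)]; exact h.2⟩⟩
        loopless := ⟨fun x h => h.1 rfl⟩ }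
    refine ⟨U, K, ⟨fun _ => M, ⟨(Equiv.subtypeUnivEquiv fun x => ?_).symm, ?_⟩⟩, ih K ?_⟩
    · let _ : (expLang subsetComplementation.symbols).Structure U :=
        expStructure G (fun _ : Unit => M)
      exact FirstOrder.Language.BoundedFormula.realize_top.2 trivial
    · intro x y
      exact sat_complFormula G (fun _ => M) x y
    · intro a b hab
      rw [h a b hab]
      have hab' : e a ≠ e b := fun h => hab (e.injective h)
      simp only [K, OddlyTogether, Xor]
      tauto

/-! ### The normal form of non-copying transductions -/

/-- A formula `ψ(x, y)` is determined by local types of `(x, y)` and, if `x` and `y` are far apart,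
by those of `x` and of `y`. -/
theorem exists_sat_iff_of_localType_eq {S : Type} (ψ : (expLang S).Formula (Fin 2)) :
    ∃ N L : ℕ, ∀ (V : Type u) (G : SimpleGraph V) (P : S → Set V) (x y x' y' : V),
      (localType G P N L ![x, y] = localType G P N L ![x', y'] →
        (Sat G P ψ ![x, y] ↔ Sat G P ψ ![x', y'])) ∧
      (¬ G.edist x y ≤ (((2 * L + 1) * N : ℕ) : ℕ∞) →
        ¬ G.edist x' y' ≤ (((2 * L + 1) * N : ℕ) : ℕ∞) →
        localType G P N L ![x] = localType G P N L ![x'] →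
        localType G P N L ![y] = localType G P N L ![y'] →
        (Sat G P ψ ![x, y] ↔ Sat G P ψ ![x', y'])) := by
  obtain ⟨N, L, h⟩ := exists_realize_iff_of_localEquiv.{u} ψ 2
  refine ⟨N, L, fun V G P x y x' y' => ?_⟩
  have key : LocalEquiv G P G P N L {(x, x'), (y, y')} →
      (Sat G P ψ ![x, y] ↔ Sat G P ψ ![x', y']) := by
    intro hR
    refine h V G P _ ((Set.encard_insert_le _ _).trans (by rw [Set.encard_singleton]; norm_num)) hR
      ![x, y] ![x', y'] _ _ ?_ (fun i => i.elim0)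
    intro i
    fin_cases i <;> simp
  refine ⟨fun ht => key ?_, fun hxy hxy' hx hy => key ?_⟩
  · rw [← localEquiv_range_iff] at ht
    refine ht.mono_subset le_rfl ?_
    rintro _ (rfl | rfl)
    exacts [⟨0, rfl⟩, ⟨1, rfl⟩]
  · rw [← localEquiv_singleton_iff] at hx hy
    rw [Set.insert_eq]
    refine hx.union hy ?_ ?_
    · rintro _ rfl _ rfl
      exact hxy
    · rintro _ rfl _ rfl
      exact hxy'

theorem localType_singleton_eq_of_pair_eq {S : Type} {V : Type u} (G : SimpleGraph V)
    (P : S → Set V) (N L : ℕ) {x y x' y' : V}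
    (h : localType G P N L ![x, y] = localType G P N L ![x', y']) :
    localType G P N L ![x] = localType G P N L ![x'] ∧
      localType G P N L ![y] = localType G P N L ![y'] := by
  rw [← localEquiv_range_iff] at h
  rw [← localEquiv_singleton_iff, ← localEquiv_singleton_iff]
  constructor
  · exact h.mono_subset le_rfl (Set.singleton_subset_iff.2 ⟨0, rfl⟩)
  · exact h.mono_subset le_rfl (Set.singleton_subset_iff.2 ⟨1, rfl⟩)

/-- The interpretation whose vertices are marked by a unary symbol, and whose edges are the pairs at
distance at most `D` whose local type is marked by another unary symbol. -/
theorem exists_isStronglyLocal_interpretation (S : Type) [Finite S] (N L D : ℕ) :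
    ∃ I : SimpleInterpretation.{u} (S ⊕ Option (LocalType S N L 2)), I.IsStronglyLocal ∧
      (∀ (V : Type u) G P v, Sat G P I.ν v ↔ v 0 ∈ (P (.inr none) : Set V)) ∧
      ∀ (V : Type u) (G : SimpleGraph V) P v, Sat G P I.η v ↔ v 0 ≠ v 1 ∧
        (G.edist (v 0) (v 1) ≤ (D : ℕ∞) ∧ v 0 ∈ (P (.inr (some
          (localType G (fun s => P (.inl s)) N L ![v 0, v 1]))) : Set V)) ∧
        (G.edist (v 1) (v 0) ≤ (D : ℕ∞) ∧ v 1 ∈ (P (.inr (some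
          (localType G (fun s => P (.inl s)) N L ![v 1, v 0]))) : Set V)) := by
  obtain ⟨I, hν, hη⟩ := exists_simpleInterpretation.{u} (S := S ⊕ Option (LocalType S N L 2))
    (ν := fun V G P x => x ∈ P (.inr none))
    (η := fun V G P x y => G.edist x y ≤ (D : ℕ∞) ∧
      x ∈ P (.inr (some (localType G (fun s => P (.inl s)) N L ![x, y]))))
    (Expressible.mem _ 0) (by
      refine (Expressible.edist_le D 0 1).and (Expressible.congr
        (Expressible.exists_finite fun t : LocalType S N L 2 =>
          ((Expressible.localType_eq N L 2 t).reduct (S' := S ⊕ Option (LocalType S N L 2))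
            Sum.inl).and (Expressible.mem (.inr (some t)) 0)) fun V G P v => ?_)
      have : ![v 0, v 1] = v := by
        funext i; fin_cases i <;> rfl
      rw [this]
      exact ⟨fun ⟨t, h, h'⟩ => h ▸ h', fun h => ⟨_, rfl, h⟩⟩)
  refine ⟨I, ⟨max D ((L + 1) * N), ⟨fun V G P v => ?_, fun V G P v _ i j hij => by omega⟩,
    fun V G P v => ?_, fun V G P v h i j hij => ?_⟩, hν, hη⟩
  · rw [hν, hν]; rfl
  · rw [hη, hη]
    have hball : ∀ i z d, d ≤ max D ((L + 1) * N) → G.edist (v i) z ≤ (d : ℕ∞) →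
        z ∈ ball G (max D ((L + 1) * N)) v := fun i z d hd hz => ⟨i, edist_le_mono _ hz hd⟩
    have htype : ∀ i j : Fin 2, localType (G.induce (ball G (max D ((L + 1) * N)) v))
        (fun s => {w : ball G (max D ((L + 1) * N)) v | (w : V) ∈ P (.inl s)}) N L
        ![⟨v i, mem_ball _ _ _ i⟩, ⟨v j, mem_ball _ _ _ j⟩] =
        localType G (fun s => P (.inl s)) N L ![v i, v j] := by
      intro i j
      have hv : ∀ m, ![v i, v j] m ∈ ball G (max D ((L + 1) * N)) v := by
        intro m
        fin_cases m
        exacts [mem_ball _ _ _ i, mem_ball _ _ _ j]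
      rw [← localType_induce G (fun s => P (.inl s)) N L (ball G (max D ((L + 1) * N)) v)
        ![v i, v j] hv ?_]
      · congr 1
        funext m
        fin_cases m <;> rfl
      · intro m z hz
        fin_cases m
        exacts [hball i z _ (le_max_right _ _) hz, hball j z _ (le_max_right _ _) hz]
    have hdist : ∀ i j : Fin 2, (G.induce (ball G (max D ((L + 1) * N)) v)).edist
        ⟨v i, mem_ball _ _ _ i⟩ ⟨v j, mem_ball _ _ _ j⟩ ≤ (D : ℕ∞) ↔
        G.edist (v i) (v j) ≤ (D : ℕ∞) := fun i j =>
      edist_induce_le_iff _ _ _ _ _ fun z hz => hball i z _ (le_max_left _ _) hz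
    rw [hdist, hdist, htype, htype, ne_eq, ne_eq, Subtype.mk.injEq]
    rfl
  · have : i = 0 ∧ j = 1 := by omega
    rw [this.1, this.2]
    exact edist_le_mono _ ((hη V G P v).1 h).2.1.1 (le_max_left _ _)

/-- The normal form of a non-copying transduction.

The adjacency of far apart vertices `x`, `y` only depends on their local types, and so can be
realized by a perturbation. What remains to be realized by the immersive transduction is the
difference between the adjacency and the effect of the perturbation, restricted to pairs at bounded
distance; it only depends on the local type of the pair, and the expansion marks those local types
for which both disagree. -/
theorem NonCopyingTransduction.exists_isImmersive (T : NonCopyingTransduction.{u}) :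
    ∃ (Timm : NonCopyingTransduction.{u}) (P : Transduction.{u}),
      Timm.IsImmersive ∧ P.IsPerturbation ∧
      ∀ (V : Type u) (G : SimpleGraph V) (W : Type u) (H : SimpleGraph W), T.Produces G H →
        StepsProduce (Step.nonCopying Timm :: P.steps) G H := by
  have := T.finite_symbols
  obtain ⟨N, L, hη⟩ := exists_sat_iff_of_localType_eq.{u} T.interpretation.η
  obtain ⟨D, hD⟩ : ∃ D, D = (2 * L + 1) * N := ⟨_, rfl⟩
  rw [← hD] at hη
  obtain ⟨m, hm⟩ := exists_oddlyTogether_iff (LocalType T.symbols N L 1)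
  obtain ⟨I, hI, hIν, hIη⟩ := exists_isStronglyLocal_interpretation.{u} T.symbols N L D
  refine ⟨⟨_, inferInstance, I⟩, ⟨List.replicate m (Step.nonCopying subsetComplementation)⟩, hI,
    ⟨m, rfl⟩, ?_⟩
  rintro V G W H ⟨P, ⟨f⟩⟩
  let τ : V → LocalType T.symbols N L 1 := fun x => localType G P N L ![x]
  let adj : V → V → Prop := fun x y => Sat G P T.interpretation.η ![x, y]
  have adj_comm : ∀ x y, adj x y ↔ adj y x := T.interpretation.symm V G P
  -- The relation between local types that governs adjacency at large distance.
  let R : LocalType T.symbols N L 1 → LocalType T.symbols N L 1 → Prop := fun c d =>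
    ∃ x y, ¬ G.edist x y ≤ (D : ℕ∞) ∧ τ x = c ∧ τ y = d ∧ adj x y
  have hR : ∀ c d, R c d → R d c := by
    rintro c d ⟨x, y, hxy, hx, hy, h⟩
    exact ⟨y, x, by rwa [SimpleGraph.edist_comm], hy, hx, (adj_comm x y).1 h⟩
  have hRcomm : ∀ c d, R c d ↔ R d c := fun c d => ⟨hR c d, hR d c⟩
  have hfar : ∀ x y, ¬ G.edist x y ≤ (D : ℕ∞) → (adj x y ↔ R (τ x) (τ y)) := by
    intro x y hxy
    refine ⟨fun h => ⟨x, y, hxy, rfl, rfl, h⟩, ?_⟩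
    rintro ⟨x', y', hxy', hx, hy, h⟩
    exact ((hη V G P x y x' y').2 hxy hxy' hx.symm hy.symm).2 h
  obtain ⟨l, hl, hlR⟩ := hm R hR
  let P' : T.symbols ⊕ Option (LocalType T.symbols N L 2) → Set V := Sum.elim P fun o =>
    match o with
    | none => {x | Sat G P T.interpretation.ν ![x]}
    | some t => {_x | ∃ x y, localType G P N L ![x, y] = t ∧ Xor (adj x y) (R (τ x) (τ y))}
  have hmark : ∀ x y z, z ∈ P' (.inr (some (localType G P N L ![x, y]))) ↔
      Xor (adj x y) (R (τ x) (τ y)) := by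
    intro x y z
    refine ⟨?_, fun h => ⟨x, y, rfl, h⟩⟩
    rintro ⟨x', y', ht, h⟩
    obtain ⟨hx, hy⟩ := localType_singleton_eq_of_pair_eq G P N L ht
    have hadj : adj x' y' ↔ adj x y := (hη V G P x' y' x y).1 ht
    change τ x' = τ x at hx
    change τ y' = τ y at hy
    rwa [hadj, hx, hy] at h
  have hν : ∀ x, Sat G P' I.ν ![x] ↔ Sat G P T.interpretation.ν ![x] := fun x => hIν V G P' ![x]
  have hηI : ∀ x y, Sat G P' I.η ![x, y] ↔ x ≠ y ∧ G.edist x y ≤ (D : ℕ∞) ∧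
      Xor (adj x y) (R (τ x) (τ y)) := by
    intro x y
    have hxy := hmark x y x
    have hyx := hmark y x y
    rw [adj_comm y x, hRcomm] at hyx
    refine (hIη V G P' ![x, y]).trans ?_
    change x ≠ y ∧ (_ ∧ x ∈ P' (.inr (some (localType G P N L ![x, y])))) ∧
      (G.edist y x ≤ _ ∧ y ∈ P' (.inr (some (localType G P N L ![y, x])))) ↔ _
    rw [hxy, hyx, SimpleGraph.edist_comm (u := y)]
    exact and_congr_right fun _ => and_self_iff
  refine ⟨_, I.interp G P', ⟨P', ⟨RelIso.refl _⟩⟩, ?_⟩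
  have hlen : m = (l.map ((fun x : {x : V // Sat G P' I.ν ![x]} => τ x) ⁻¹' ·)).length := by
    rw [List.length_map, hl]
  rw [hlen]
  refine stepsProduce_replicate_subsetComplementation _ _ _
    (f.toEquiv.trans (Equiv.subtypeEquivRight fun x => (hν x).symm)) fun a b hab => ?_
  rw [oddlyTogether_map, hlR]
  have h1 : H.Adj a b ↔ adj (f a).1 (f b).1 := f.map_rel_iff.symm
  have hne : (f a).1 ≠ (f b).1 := fun h => hab (f.injective (Subtype.ext h))
  rw [h1]
  refine Iff.trans ?_ (iff_of_eq (congrArg₂ Xor (propext (hηI (f a).1 (f b).1)).symm rfl))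
  have h2 := hfar (f a).1 (f b).1
  change _ ↔ Xor _ (R (τ (f a).1) (τ (f b).1))
  rw [and_iff_right hne]
  exact iff_xor_and_xor_of_imp h2

/-! ### Isomorphism invariance -/

open FirstOrder Language in
theorem sat_iff_of_iso {S : Type} {V W : Type u} {G : SimpleGraph V} {H : SimpleGraph W}
    {P : S → Set V} {Q : S → Set W} (e : G ≃g H) (hPQ : ∀ s x, x ∈ P s ↔ e x ∈ Q s) {k : ℕ}
    (φ : (expLang S).Formula (Fin k)) (v : Fin k → V) :
    Sat G P φ v ↔ Sat H Q φ (fun i => e (v i)) := by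
  let _ := expStructure G P
  let _ := expStructure H Q
  let F : V ≃[expLang S] W :=
    { toEquiv := e.toEquiv
      map_fun' := fun f => Empty.elim f
      map_rel' := fun r x => by
        cases r with
        | adj => exact e.map_rel_iff
        | unary s => exact (hPQ s _).symm }
  exact (StrongHomClass.realize_formula F φ (v := v)).symm

/-- The interpretations of isomorphic expanded graphs are isomorphic. -/
theorem SimpleInterpretation.interp_iso {S : Type} (I : SimpleInterpretation.{u} S) {V W : Type u}
    {G : SimpleGraph V} {H : SimpleGraph W} {P : S → Set V} {Q : S → Set W} (e : G ≃g H)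
    (hPQ : ∀ s x, x ∈ P s ↔ e x ∈ Q s) : Nonempty (I.interp G P ≃g I.interp H Q) := by
  have h₁ : ∀ x, Sat G P I.ν ![x] ↔ Sat H Q I.ν ![e x] := fun x => by
    rw [sat_iff_of_iso e hPQ]
    exact iff_of_eq (congrArg _ (by funext i; fin_cases i; rfl))
  have h₂ : ∀ x y, Sat G P I.η ![x, y] ↔ Sat H Q I.η ![e x, e y] := fun x y => by
    rw [sat_iff_of_iso e hPQ]
    exact iff_of_eq (congrArg _ (by funext i; fin_cases i <;> rfl))
  exact ⟨⟨e.toEquiv.subtypeEquiv h₁, fun {a b} => (h₂ a.1 b.1).symm⟩⟩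

theorem NonCopyingTransduction.Produces.congr {T : NonCopyingTransduction.{u}} {V V' W W' : Type u}
    {G : SimpleGraph V} {G' : SimpleGraph V'} {H : SimpleGraph W} {H' : SimpleGraph W'}
    (h : T.Produces G H) (e : G ≃g G') (f : H' ≃g H) : T.Produces G' H' := by
  obtain ⟨P, ⟨g⟩⟩ := h
  obtain ⟨i⟩ := T.interpretation.interp_iso (Q := fun s => e.symm ⁻¹' P s) e
    (P := P) (fun s x => by simp)
  exact ⟨_, ⟨(f.trans g).trans i⟩⟩

/-- Isomorphic graphs have isomorphic copies. -/
def copyGraphIso (k : ℕ) {V W : Type u} {G : SimpleGraph V} {H : SimpleGraph W} (e : G ≃g H) :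
    copyGraph k G ≃g copyGraph k H where
  toEquiv := e.toEquiv.prodCongr (Equiv.refl _)
  map_rel_iff' {a b} := by
    change (H.Adj (e a.1) (e b.1) ∧ a.2 = b.2) ∨ (e a.1 = e b.1 ∧ a.2 ≠ b.2) ↔ _
    rw [e.map_adj_iff, e.apply_eq_iff_eq]
    rfl

/-! ### Compositions of elementary transductions -/

/-- A definable set of vertices and a definable relation, made symmetric and anti-reflexive, give a
non-copying transduction. -/
theorem exists_nonCopyingTransduction {S : Type} [Finite S]
    {ν : ∀ V : Type u, SimpleGraph V → (S → Set V) → V → Prop}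
    {η : ∀ V : Type u, SimpleGraph V → (S → Set V) → V → V → Prop}
    (hν : Expressible (α := Fin 1) fun V G P v => ν V G P (v 0))
    (hη : Expressible (α := Fin 2) fun V G P v => η V G P (v 0) (v 1)) :
    ∃ T : NonCopyingTransduction.{u}, ∀ (V : Type u) (G : SimpleGraph V) (P : S → Set V)
      (W : Type u) (H : SimpleGraph W) (e : W ≃ {x // ν V G P x}),
      (∀ a b, H.Adj a b ↔ (e a).1 ≠ (e b).1 ∧ η V G P (e a) (e b) ∧ η V G P (e b) (e a)) →
      T.Produces G H := by
  obtain ⟨I, hIν, hIη⟩ := exists_simpleInterpretation hν hη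
  refine ⟨⟨S, inferInstance, I⟩, fun V G P W H e h => ⟨P, ⟨⟨e.trans
    (Equiv.subtypeEquivRight fun x => (hIν V G P ![x]).symm), fun {a b} => ?_⟩⟩⟩⟩
  rw [h]
  exact hIη V G P ![(e a).1, (e b).1]

open FirstOrder Language in
/-- The form of `realize_restrict` for formulas without bound context. -/
theorem Expressible.sat_restrict {S T : Type} {k : ℕ}
    {ν : ∀ V : Type u, SimpleGraph V → (S → Set V) → V → Prop}
    (H : ∀ (V : Type u) (G : SimpleGraph V) (P : S → Set V), SimpleGraph {x // ν V G P x})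
    (C : ∀ (V : Type u) (G : SimpleGraph V) (P : S → Set V), T → Set {x // ν V G P x})
    (hν : Expressible (α := Fin 1) fun V G P v => ν V G P (v 0))
    (hH : Expressible (α := Fin 2) fun V G P v =>
      ∃ h₀ h₁, (H V G P).Adj ⟨v 0, h₀⟩ ⟨v 1, h₁⟩)
    (hC : ∀ t, Expressible (α := Fin 1) fun V G P v => ∃ h, ⟨v 0, h⟩ ∈ C V G P t)
    (φ : (expLang T).Formula (Fin k)) :
    Expressible fun V G P v => ∃ h : ∀ i, ν V G P (v i),
      Sat (H V G P) (C V G P) φ (fun i => ⟨v i, h i⟩) := by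
  refine ((realize_restrict H C hν hH hC φ).comp (Sum.elim id Fin.elim0)).congr
    fun V G P v => ?_
  have key : ∀ (h : ∀ i, ν V G P (v i)) (xs : Fin 0 → {x // ν V G P x}),
      letI := expStructure (H V G P) (C V G P)
      BoundedFormula.Realize φ (fun i => (⟨v i, h i⟩ : {x // ν V G P x})) xs ↔
        Sat (H V G P) (C V G P) φ (fun i => ⟨v i, h i⟩) := by
    intro h xs
    rw [Subsingleton.elim xs default]
    rfl
  constructor
  · rintro ⟨h, h'⟩
    exact ⟨fun i => h (.inl i), (key (fun i => h (.inl i)) _).1 h'⟩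
  · rintro ⟨h, h'⟩
    refine ⟨fun i => ?_, (key h _).2 h'⟩
    cases i with
    | inl i => exact h i
    | inr j => exact j.elim0

/-- The curried form of `sat_restrict` for one and for two variables. -/
theorem Expressible.sat_restrict_curry {S T : Type}
    {ν : ∀ V : Type u, SimpleGraph V → (S → Set V) → V → Prop}
    (H : ∀ (V : Type u) (G : SimpleGraph V) (P : S → Set V), SimpleGraph {x // ν V G P x})
    (C : ∀ (V : Type u) (G : SimpleGraph V) (P : S → Set V), T → Set {x // ν V G P x})
    (hν : Expressible (α := Fin 1) fun V G P v => ν V G P (v 0))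
    (hH : Expressible (α := Fin 2) fun V G P v =>
      ∃ h₀ h₁, (H V G P).Adj ⟨v 0, h₀⟩ ⟨v 1, h₁⟩)
    (hC : ∀ t, Expressible (α := Fin 1) fun V G P v => ∃ h, ⟨v 0, h⟩ ∈ C V G P t)
    (φ : (expLang T).Formula (Fin 1)) (ψ : (expLang T).Formula (Fin 2)) :
    (Expressible (α := Fin 1) fun V G P v => ∃ h, Sat (H V G P) (C V G P) φ ![⟨v 0, h⟩]) ∧
    Expressible (α := Fin 2) fun V G P v =>
      ∃ h₀ h₁, Sat (H V G P) (C V G P) ψ ![⟨v 0, h₀⟩, ⟨v 1, h₁⟩] := by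
  constructor
  · refine (sat_restrict H C hν hH hC φ).congr fun V G P v => ?_
    have key : ∀ h : ∀ i, ν V G P (v i),
        (fun i => (⟨v i, h i⟩ : {x // ν V G P x})) = ![⟨v 0, h 0⟩] := fun h => by
      funext i; fin_cases i; rfl
    exact ⟨fun ⟨h, h'⟩ => ⟨h 0, key h ▸ h'⟩, fun ⟨h, h'⟩ =>
      ⟨fun i => by rwa [Subsingleton.elim i 0], by rwa [key]⟩⟩
  · refine (sat_restrict H C hν hH hC ψ).congr fun V G P v => ?_
    have key : ∀ h : ∀ i, ν V G P (v i),
        (fun i => (⟨v i, h i⟩ : {x // ν V G P x})) = ![⟨v 0, h 0⟩, ⟨v 1, h 1⟩] := fun h => by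
      funext i; fin_cases i <;> rfl
    exact ⟨fun ⟨h, h'⟩ => ⟨h 0, h 1, key h ▸ h'⟩, fun ⟨h₀, h₁, h'⟩ =>
      ⟨fun i => by fin_cases i; exacts [h₀, h₁], by rwa [key]⟩⟩

theorem Expressible.sat {S : Type} {k : ℕ} (φ : (expLang S).Formula (Fin k)) :
    Expressible fun (_ : Type u) G P v => Sat G P φ v :=
  ⟨φ, fun _ _ _ _ => Iff.rfl⟩

/-- Non-copying transductions are closed under composition: the marks that the second one reads on
the intermediate graph are guessed on the input graph. -/
theorem NonCopyingTransduction.exists_comp (T₁ T₂ : NonCopyingTransduction.{u}) :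
    ∃ T : NonCopyingTransduction.{u}, ∀ {V U W : Type u} (G : SimpleGraph V) (K : SimpleGraph U)
      (H : SimpleGraph W), T₁.Produces G K → T₂.Produces K H → T.Produces G H := by
  have := T₁.finite_symbols
  have := T₂.finite_symbols
  let ν₁ : ∀ V : Type u, SimpleGraph V → (T₁.symbols ⊕ T₂.symbols → Set V) → V → Prop :=
    fun V G P x => Sat G (fun s => P (.inl s)) T₁.interpretation.ν ![x]
  let K : ∀ (V : Type u) (G : SimpleGraph V) (P : T₁.symbols ⊕ T₂.symbols → Set V),
      SimpleGraph {x // ν₁ V G P x} :=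
    fun V G P => T₁.interpretation.interp G (fun s => P (.inl s))
  let C : ∀ (V : Type u) (G : SimpleGraph V) (P : T₁.symbols ⊕ T₂.symbols → Set V),
      T₂.symbols → Set {x // ν₁ V G P x} := fun V G P s => {x | x.1 ∈ P (.inr s)}
  have hν₁ : Expressible (α := Fin 1) fun V G P v => ν₁ V G P (v 0) :=
    ((Expressible.sat T₁.interpretation.ν).reduct Sum.inl).congr fun V G P v =>
      iff_of_eq (congrArg _ (by funext i; fin_cases i; rfl))
  have hK : Expressible (α := Fin 2) fun V G P v =>
      ∃ h₀ h₁, (K V G P).Adj ⟨v 0, h₀⟩ ⟨v 1, h₁⟩ := by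
    refine ((hν₁.comp fun _ => (0 : Fin 2)).and ((hν₁.comp fun _ => (1 : Fin 2)).and
      ((Expressible.sat T₁.interpretation.η).reduct Sum.inl))).congr fun V G P v => ?_
    have key : Sat G (fun s => P (.inl s)) T₁.interpretation.η v ↔
        Sat G (fun s => P (.inl s)) T₁.interpretation.η ![v 0, v 1] :=
      iff_of_eq (congrArg _ (by funext i; fin_cases i <;> rfl))
    constructor
    · rintro ⟨h₀, h₁, h⟩
      exact ⟨h₀, h₁, key.1 h⟩
    · rintro ⟨h₀, h₁, h⟩
      exact ⟨h₀, h₁, key.2 h⟩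
  have hC : ∀ s, Expressible (α := Fin 1) fun V G P v => ∃ h, ⟨v 0, h⟩ ∈ C V G P s := by
    refine fun s => (hν₁.and (Expressible.mem (Sum.inr s : T₁.symbols ⊕ T₂.symbols) 0)).congr
      fun V G P v => ?_
    constructor
    · rintro ⟨h, h'⟩
      exact ⟨h, h'⟩
    · rintro ⟨h, h'⟩
      exact ⟨h, h'⟩
  obtain ⟨hν, hη⟩ := Expressible.sat_restrict_curry K C hν₁ hK hC
    T₂.interpretation.ν T₂.interpretation.η
  obtain ⟨T, hT⟩ := exists_nonCopyingTransduction
    (ν := fun V G P x => ∃ h, Sat (K V G P) (C V G P) T₂.interpretation.ν ![⟨x, h⟩])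
    (η := fun V G P x y =>
      ∃ h₀ h₁, Sat (K V G P) (C V G P) T₂.interpretation.η ![⟨x, h₀⟩, ⟨y, h₁⟩]) hν hη
  refine ⟨T, ?_⟩
  rintro V U W G K' H ⟨P₁, ⟨f⟩⟩ h
  obtain ⟨P₂, ⟨g⟩⟩ := h.congr f (RelIso.refl _)
  obtain ⟨P, hP⟩ : ∃ P : T₁.symbols ⊕ T₂.symbols → Set V,
    P = Sum.elim P₁ (fun s => Subtype.val '' P₂ s) := ⟨_, rfl⟩
  have hP₁ : (fun s => P (.inl s)) = P₁ := by rw [hP]; rfl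
  subst hP₁
  have hC : C V G P = P₂ := by
    funext s
    ext x
    have : P (.inr s) = Subtype.val '' P₂ s := congrFun hP (.inr s)
    change x.1 ∈ P (.inr s) ↔ _
    rw [this]
    exact Subtype.val_injective.mem_set_image
  subst hC
  refine hT V G P W H (g.toEquiv.trans (Equiv.subtypeSubtypeEquivSubtypeExists _ _)) fun a b => ?_
  have h₁ : H.Adj a b ↔ Sat (K V G P) (C V G P) T₂.interpretation.η ![(g a).1, (g b).1] :=
    g.map_rel_iff.symm
  have h₂ := T₂.interpretation.symm _ (K V G P) (C V G P) (g a).1 (g b).1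
  rw [h₁]
  constructor
  · intro h
    exact ⟨fun h' => T₂.interpretation.irrefl _ _ _ _ _ h (Subtype.ext h'),
      ⟨(g a).1.2, (g b).1.2, h⟩, ⟨(g b).1.2, (g a).1.2, h₂.1 h⟩⟩
  · rintro ⟨-, ⟨_, _, h⟩, -⟩
    exact h

/-- A graph is a non-copying transduction of its only copy. -/
theorem exists_nonCopyingTransduction_copyGraph_one :
    ∃ T : NonCopyingTransduction.{u}, ∀ {V W : Type u} (G : SimpleGraph V) (H : SimpleGraph W),
      Nonempty (H ≃g G) → T.Produces (copyGraph 1 G) H := by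
  obtain ⟨T, hT⟩ := exists_nonCopyingTransduction.{u} (S := Empty)
    (ν := fun _ _ _ _ => True) (η := fun _ G _ x y => G.Adj x y) (Expressible.const True)
    (Expressible.adj 0 1)
  refine ⟨T, fun {V W} G H ⟨f⟩ => hT _ _ Empty.elim W H
    ((f.toEquiv.trans (Equiv.prodUnique V (Fin 1)).symm).trans
      (Equiv.subtypeUnivEquiv fun _ => trivial).symm) fun a b => ?_⟩
  rw [← f.map_adj_iff]
  change _ ↔ ((f a, _) : V × Fin 1) ≠ (f b, _) ∧ (copyGraph 1 G).Adj (f a, _) (f b, _) ∧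
    (copyGraph 1 G).Adj (f b, _) (f a, _)
  simp only [copyGraph]
  constructor
  · intro h
    exact ⟨fun h' => h.ne (congrArg Prod.fst h'), Or.inl ⟨h, trivial⟩, Or.inl ⟨h.symm, trivial⟩⟩
  · rintro ⟨-, h | h, -⟩
    · exact h.1
    · exact absurd rfl h.2

/-- Copies of copies are a non-copying transduction of sufficiently many copies: if `(i, j)` is the
`j`-th copy of the `i`-th copy, those edges between copies `(i, j)` and `(i', j')` of a vertex have
to be kept for which `i = i'` or `j = j'`. -/
theorem exists_nonCopyingTransduction_copyGraph_copyGraph (k l : ℕ) :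
    ∃ T : NonCopyingTransduction.{u}, ∀ {V : Type u} (G : SimpleGraph V),
      T.Produces (copyGraph (k * l) G) (copyGraph l (copyGraph k G)) := by
  obtain ⟨T, hT⟩ := exists_nonCopyingTransduction.{u} (S := Fin k × Fin l)
    (ν := fun _ _ _ _ => True)
    (η := fun _ G P x y => G.Adj x y ∧ ∃ i j : Fin k × Fin l, (i.1 = j.1 ∨ i.2 = j.2) ∧
      x ∈ P i ∧ y ∈ P j) (Expressible.const True)
    ((Expressible.adj 0 1).and (Expressible.exists_finite fun i =>
      Expressible.exists_finite fun j =>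
      (Expressible.const _).and ((Expressible.mem i 0).and (Expressible.mem j 1))))
  refine ⟨T, fun {V} G => hT _ _ (fun i => {x | x.2 = finProdFinEquiv i}) _ _
    (((Equiv.prodAssoc V (Fin k) (Fin l)).trans
      ((Equiv.refl V).prodCongr finProdFinEquiv)).trans
      (Equiv.subtypeUnivEquiv fun _ => trivial).symm) ?_⟩
  rintro ⟨⟨x, i⟩, j⟩ ⟨⟨y, i'⟩, j'⟩
  change ((G.Adj x y ∧ i = i' ∨ x = y ∧ i ≠ i') ∧ j = j' ∨ (x, i) = (y, i') ∧ j ≠ j') ↔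
    (x, finProdFinEquiv (i, j)) ≠ (y, finProdFinEquiv (i', j')) ∧
    (((G.Adj x y ∧ finProdFinEquiv (i, j) = finProdFinEquiv (i', j')) ∨
      (x = y ∧ finProdFinEquiv (i, j) ≠ finProdFinEquiv (i', j'))) ∧
      ∃ a b : Fin k × Fin l, (a.1 = b.1 ∨ a.2 = b.2) ∧
        finProdFinEquiv (i, j) = finProdFinEquiv a ∧
        finProdFinEquiv (i', j') = finProdFinEquiv b) ∧
    (((G.Adj y x ∧ finProdFinEquiv (i', j') = finProdFinEquiv (i, j)) ∨
      (y = x ∧ finProdFinEquiv (i', j') ≠ finProdFinEquiv (i, j))) ∧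
      ∃ a b : Fin k × Fin l, (a.1 = b.1 ∨ a.2 = b.2) ∧
        finProdFinEquiv (i', j') = finProdFinEquiv a ∧
        finProdFinEquiv (i, j) = finProdFinEquiv b)
  have hE : ∀ (i i' : Fin k) (j j' : Fin l), (∃ a b : Fin k × Fin l, (a.1 = b.1 ∨ a.2 = b.2) ∧
      finProdFinEquiv (i, j) = finProdFinEquiv a ∧
      finProdFinEquiv (i', j') = finProdFinEquiv b) ↔ (i = i' ∨ j = j') := by
    intro i i' j j'
    simp only [EmbeddingLike.apply_eq_iff_eq]
    exact ⟨fun ⟨a, b, h, h₁, h₂⟩ => by subst h₁ h₂; exact h, fun h => ⟨_, _, h, rfl, rfl⟩⟩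
  rw [hE, hE, G.adj_comm y x]
  simp only [ne_eq, EmbeddingLike.apply_eq_iff_eq, Prod.mk.injEq, eq_comm (a := y),
    eq_comm (a := i'), eq_comm (a := j')]
  have hne : x = y → ¬ G.Adj x y := fun h h' => h'.ne h
  tauto

/-- Copying the output of a non-copying transduction can be postponed: after copying the input, the
transduction is simulated in one of the copies, and transferred to the other ones along the edges
between the copies of a vertex. -/
theorem NonCopyingTransduction.exists_copyGraph (T₀ : NonCopyingTransduction.{u}) {k : ℕ}
    (hk : 0 < k) :
    ∃ T : NonCopyingTransduction.{u}, ∀ {V U : Type u} (G : SimpleGraph V) (K : SimpleGraph U),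
      T₀.Produces G K → T.Produces (copyGraph k G) (copyGraph k K) := by
  have := T₀.finite_symbols
  let S := T₀.symbols ⊕ Fin k
  let ν₀ : ∀ V : Type u, SimpleGraph V → (S → Set V) → V → Prop :=
    fun V G P x => x ∈ P (.inr ⟨0, hk⟩)
  let G₀ : ∀ (V : Type u) (G : SimpleGraph V) (P : S → Set V), SimpleGraph {x // ν₀ V G P x} :=
    fun V G P => G.comap Subtype.val
  let C : ∀ (V : Type u) (G : SimpleGraph V) (P : S → Set V), T₀.symbols →
      Set {x // ν₀ V G P x} := fun V G P s => {x | x.1 ∈ P (.inl s)}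
  have hν₀ : ∀ {α : Type} (i : α), Expressible (α := α) fun V G P v => ν₀ V G P (v i) :=
    fun i => Expressible.mem _ i
  obtain ⟨hν, hη⟩ := Expressible.sat_restrict_curry G₀ C (hν₀ 0)
    (((hν₀ 0).and ((hν₀ 1).and (Expressible.adj 0 1))).congr fun V G P v =>
      ⟨fun ⟨h₀, h₁, h⟩ => ⟨h₀, h₁, h⟩, fun ⟨h₀, h₁, h⟩ => ⟨h₀, h₁, h⟩⟩)
    (fun s => ((hν₀ 0).and (Expressible.mem (Sum.inl s : S) 0)).congr fun V G P v =>
      ⟨fun ⟨h, h'⟩ => ⟨h, h'⟩, fun ⟨h, h'⟩ => ⟨h, h'⟩⟩)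
    T₀.interpretation.ν T₀.interpretation.η
  -- The copy of `x` in the marked copy of the input graph.
  let proj : ∀ V : Type u, SimpleGraph V → (S → Set V) → V → V → Prop := fun V G P x z =>
    ν₀ V G P z ∧ (z = x ∨ ¬ ν₀ V G P x ∧ G.Adj x z)
  have hproj : ∀ {α : Type} (i j : α), Expressible fun V G P v => proj V G P (v i) (v j) :=
    fun i j => (hν₀ j).and ((Expressible.eq j i).or ((hν₀ i).not.and (Expressible.adj i j)))
  obtain ⟨T, hT⟩ := exists_nonCopyingTransduction.{u} (S := S)
    (ν := fun V G P x => ∃ z, proj V G P x z ∧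
      ∃ h, Sat (G₀ V G P) (C V G P) T₀.interpretation.ν ![⟨z, h⟩])
    (η := fun V G P x y => ((∃ i, x ∈ P (.inr i) ∧ y ∈ P (.inr i)) ∧ ∃ z, ∃ w, proj V G P x z ∧
      proj V G P y w ∧
      ∃ h₀ h₁, Sat (G₀ V G P) (C V G P) T₀.interpretation.η ![⟨z, h₀⟩, ⟨w, h₁⟩]) ∨
      ((¬ ∃ i, x ∈ P (.inr i) ∧ y ∈ P (.inr i)) ∧ G.Adj x y))
    (Expressible.exists_vertex ((hproj (some 0) none).and (hν.comp fun _ => none)))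
    (by
      have hsame : Expressible (S := S) (α := Fin 2) fun (V : Type u) G P v =>
          ∃ i, v 0 ∈ P (.inr i) ∧ v 1 ∈ P (.inr i) :=
        Expressible.exists_finite fun i => (Expressible.mem _ 0).and (Expressible.mem _ 1)
      exact (hsame.and (Expressible.exists_vertex (Expressible.exists_vertex
        ((hproj (some (some 0)) (some none)).and ((hproj (some (some 1)) none).and
          (hη.comp ![some none, none])))))).or (hsame.not.and (Expressible.adj 0 1)))
  refine ⟨T, ?_⟩
  rintro V U G K ⟨P₀, ⟨f⟩⟩
  let P : S → Set (V × Fin k) :=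
    Sum.elim (fun s => {x | x.1 ∈ P₀ s}) (fun i => {x | x.2 = i})
  have hproj' : ∀ x z, proj _ (copyGraph k G) P x z ↔ z = (x.1, ⟨0, hk⟩) := by
    rintro ⟨x, i⟩ ⟨z, j⟩
    simp only [proj, copyGraph, Prod.mk.injEq]
    constructor
    · rintro ⟨rfl, ⟨rfl, rfl⟩ | ⟨h, ⟨-, h'⟩ | ⟨h', -⟩⟩⟩
      · exact ⟨rfl, rfl⟩
      · exact absurd h' h
      · exact ⟨h'.symm, rfl⟩
    · rintro ⟨rfl, rfl⟩
      refine ⟨rfl, ?_⟩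
      by_cases h : i = ⟨0, hk⟩
      · exact Or.inl ⟨rfl, h.symm⟩
      · exact Or.inr ⟨h, Or.inr ⟨rfl, h⟩⟩
  let g : G ≃g G₀ _ (copyGraph k G) P :=
    { toFun := fun x => ⟨(x, ⟨0, hk⟩), rfl⟩
      invFun := fun x => x.1.1
      left_inv := fun _ => rfl
      right_inv := fun x => Subtype.ext (Prod.ext rfl x.2.symm)
      map_rel_iff' := fun {x y} => by
        change (G.Adj x y ∧ _) ∨ (x = y ∧ _) ↔ _
        simp }
  have hg : ∀ s x, x ∈ P₀ s ↔ g x ∈ C _ (copyGraph k G) P s := fun s x => Iff.rfl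
  have hsat₁ : ∀ x : V × Fin k, (∃ z, proj _ (copyGraph k G) P x z ∧
      ∃ h, Sat (G₀ _ (copyGraph k G) P) (C _ (copyGraph k G) P) T₀.interpretation.ν ![⟨z, h⟩]) ↔
      Sat G P₀ T₀.interpretation.ν ![x.1] := by
    intro x
    simp only [hproj', exists_eq_left]
    rw [sat_iff_of_iso g hg]
    have : (fun i => g (![x.1] i)) = ![g x.1] := by funext i; fin_cases i; rfl
    rw [this]
    exact ⟨fun ⟨_, h⟩ => h, fun h => ⟨rfl, h⟩⟩
  have hsat₂ : ∀ x y : V × Fin k, (∃ z w, proj _ (copyGraph k G) P x z ∧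
      proj _ (copyGraph k G) P y w ∧ ∃ h₀ h₁, Sat (G₀ _ (copyGraph k G) P)
        (C _ (copyGraph k G) P) T₀.interpretation.η ![⟨z, h₀⟩, ⟨w, h₁⟩]) ↔
      Sat G P₀ T₀.interpretation.η ![x.1, y.1] := by
    intro x y
    simp only [hproj', exists_eq_left, exists_and_left]
    rw [sat_iff_of_iso g hg]
    have : (fun i => g (![x.1, y.1] i)) = ![g x.1, g y.1] := by funext i; fin_cases i <;> rfl
    rw [this]
    exact ⟨fun ⟨_, _, h⟩ => h, fun h => ⟨rfl, rfl, h⟩⟩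
  have hsame : ∀ x y : V × Fin k, (∃ i, x ∈ P (.inr i) ∧ y ∈ P (.inr i)) ↔ x.2 = y.2 :=
    fun x y => ⟨fun ⟨i, h, h'⟩ => Eq.trans h (Eq.symm h'), fun h => ⟨y.2, h, rfl⟩⟩
  refine hT _ _ P _ _
    { toFun := fun a => ⟨((f a.1).1, a.2), (hsat₁ _).2 (f a.1).2⟩
      invFun := fun x => (f.symm ⟨x.1.1, (hsat₁ _).1 x.2⟩, x.1.2)
      left_inv := fun a => by simp
      right_inv := fun x => by simp } ?_
  rintro ⟨a, i⟩ ⟨b, j⟩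
  have hab : K.Adj a b ↔ Sat G P₀ T₀.interpretation.η ![(f a).1, (f b).1] := f.map_rel_iff.symm
  have hba : K.Adj a b ↔ Sat G P₀ T₀.interpretation.η ![(f b).1, (f a).1] := by
    rw [K.adj_comm]; exact f.map_rel_iff.symm
  have heq : (f a).1 = (f b).1 ↔ a = b := by rw [Subtype.val_inj, f.apply_eq_iff_eq]
  have hne : K.Adj a b → a ≠ b := fun h => h.ne
  simp only [Equiv.coe_fn_mk, hsame, hsat₂, ← hab, ← hba]
  simp only [copyGraph, heq, ne_eq, Prod.mk.injEq, eq_comm (a := (f b).1), eq_comm (a := j)]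
  tauto

/-- All copy operations can be moved to the front, and merged. -/
theorem exists_nonCopyingTransduction_copyGraph (l : List Step.{u}) :
    ∃ (k : ℕ) (_ : 0 < k) (T : NonCopyingTransduction.{u}), ∀ {V W : Type u} (G : SimpleGraph V)
      (H : SimpleGraph W), StepsProduce l G H → T.Produces (copyGraph k G) H := by
  induction l with
  | nil =>
    obtain ⟨T, hT⟩ := exists_nonCopyingTransduction_copyGraph_one.{u}
    exact ⟨1, one_pos, T, fun G H h => hT G H h⟩
  | cons s l ih =>
    obtain ⟨k, hk, T, hT⟩ := ih
    cases s with
    | copy k' hk' =>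
      obtain ⟨T', hT'⟩ := exists_nonCopyingTransduction_copyGraph_copyGraph.{u} k' k
      obtain ⟨T'', hT''⟩ := T'.exists_comp T
      refine ⟨k' * k, Nat.mul_pos hk' hk, T'', ?_⟩
      rintro V W G H ⟨U, K, ⟨e⟩, h⟩
      exact hT'' _ _ _ ((hT' G).congr (RelIso.refl _) (copyGraphIso k e)) (hT K H h)
    | nonCopying T₀ =>
      obtain ⟨T', hT'⟩ := T₀.exists_copyGraph hk
      obtain ⟨T'', hT''⟩ := T'.exists_comp T
      refine ⟨k, hk, T'', ?_⟩
      rintro V W G H ⟨U, K, hK, h⟩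
      exact hT'' _ _ _ (hT' G K hK) (hT K H h)

end FOTransductions

theorem mainTheorem2 :
    (∀ T : FOTransductions.Transduction.{u},
      ∃ (k : ℕ) (hk : 0 < k) (Timm : FOTransductions.NonCopyingTransduction.{u})
        (P : FOTransductions.Transduction.{u}),
        Timm.IsImmersive ∧ P.IsPerturbation ∧
          (P.comp (Timm.toTransduction.comp (FOTransductions.copyOperation k hk))).Subsumes T) ∧
    (∀ T : FOTransductions.NonCopyingTransduction.{u},
      ∃ (Timm : FOTransductions.NonCopyingTransduction.{u})
        (P : FOTransductions.Transduction.{u}),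
        Timm.IsImmersive ∧ P.IsPerturbation ∧
          (P.comp Timm.toTransduction).Subsumes T.toTransduction) := by
  refine ⟨fun T => ?_, fun T => ?_⟩
  · obtain ⟨k, hk, T', hT'⟩ := FOTransductions.exists_nonCopyingTransduction_copyGraph T.steps
    obtain ⟨Timm, P, hTimm, hP, h⟩ := T'.exists_isImmersive
    refine ⟨k, hk, Timm, P, hTimm, hP, fun V G W H hGH => ?_⟩
    exact ⟨V × Fin k, _, ⟨RelIso.refl _⟩, h _ _ W H (hT' G H hGH)⟩
  · obtain ⟨Timm, P, hTimm, hP, h⟩ := T.exists_isImmersive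
    refine ⟨Timm, P, hTimm, hP, ?_⟩
    rintro V G W H ⟨U, K, hK, ⟨e⟩⟩
    exact h V G W H (hK.congr (RelIso.refl _) e)
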